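/- Let $M_T, M_R \ge 1$ be integers, $M=\min(M_T,M_R)$, $N=\max(M_T,M_R)$, $\kappa=\lceil M/(N-M)\rceil$ (with $\kappa=\infty$, $1/\kappa=0$ when $M=N$), and $$\mathrm{DoF}^\star=\min\left(\frac{M}{2-1/\kappa},\frac{N}{2+1/\kappa}\right).$$ Consider the 3-user $M_T\times M_R$ MIMO interference channel with complex $M_R\times M_T$ channel matrices $H_{ji}$ from transmitter $i$ to receiver $j$ ($i,j\in\{1,2,3\}$), all of whose entries are independent random variables with continuous (atomless) distributions on $\mathbb{C}$. For an integer $d\ge 0$, the per-user demand $d$ is called feasible with linear interference alignment (without symbol extensions in time, frequency or space) if almost surely there are matrices $V_i\in\mathbb{C}^{M_T\times d}$ and $U_j\in\mathbb{C}^{M_R\times d}$ with $$U_j^{\mathsf H}H_{ji}V_i=0\quad (i\neq j),\qquad \operatorname{rank}\left(U_i^{\mathsf H}H_{ii}V_i\right)=d\quad (i=1,2,3),$$ and infeasible if almost surely there are no such matrices. Then: 1. Whatever the continuous distributions are, the demand $d$ is feasible if and only if $d\le\mathrm{DoF}^\star$, i.e. if and only if $d\le\lfloor\mathrm{DoF}^\star\rfloor$,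 and it is infeasible if and only if $d>\mathrm{DoF}^\star$. 2. Call the system $(M_T\times M_R,d)^3$ proper if $d\le (M_T+M_R)/4$, and let $B=\{\frac{2p-1}{2p+1}: p=1,2,3,\dots\}=\{1/3,3/5,5/7,\dots\}$. For every rational $\gamma\in(0,1)$ with $\gamma\notin B$ there is a proper system with $M/N=\gamma$ that is infeasible for all continuous distributions. Conversely, if $M/N\in B$ or $M=N$, every proper system is feasible for all continuous distributions. -/

import Mathlib

open MeasureTheory
open scoped Matrix

/-- `κ = ⌈M / (N - M)⌉` (for `M < N`), the length of the subspace alignment chain, where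
`M = min M_T M_R` and `N = max M_T M_R`. -/
def chainLength (MT MR : ℕ) : ℕ :=
  ⌈((min MT MR : ℕ) : ℚ) / (((max MT MR : ℕ) : ℚ) - ((min MT MR : ℕ) : ℚ))⌉₊

/-- `DoF⋆ = min (M / (2 - 1/κ)) (N / (2 + 1/κ))`.  For `M = N` the chain length `κ` is infinite,
so `1/κ = 0` and the value is `M / 2`. -/
def dofStar (MT MR : ℕ) : ℚ :=
  if MT = MR then (MT : ℚ) / 2
  else
    min (((min MT MR : ℕ) : ℚ) / (2 - 1 / (chainLength MT MR : ℚ)))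
      (((max MT MR : ℕ) : ℚ) / (2 + 1 / (chainLength MT MR : ℚ)))

/-- Index set of the scalar channel coefficients of the three-user `MT × MR` channel:
`(j, i, b, a)` is the coefficient from antenna `a` of transmitter `i` to antenna `b` of
receiver `j`. -/
abbrev CoeffIndex (MT MR : ℕ) : Type := Fin 3 × Fin 3 × Fin MR × Fin MT

/-- The `MR × MT` channel matrix `H_{ji}` from transmitter `i` to receiver `j`. -/
def channelMatrix {MT MR : ℕ} (h : CoeffIndex MT MR → ℂ) (j i : Fin 3) :
    Matrix (Fin MR) (Fin MT) ℂ :=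
  Matrix.of fun b a => h (j, i, b, a)

/-- For the channel realization `h`, linear interference alignment with `d` streams per user (no
channel extensions) is solvable: there are transmit beamforming matrices `V i` and receive
(zero-forcing) matrices `U j` such that all interference is nulled and each user's `d` desired
streams remain distinguishable. -/
def AlignmentSolvable {MT MR : ℕ} (h : CoeffIndex MT MR → ℂ) (d : ℕ) : Prop :=
  ∃ (V : Fin 3 → Matrix (Fin MT) (Fin d) ℂ) (U : Fin 3 → Matrix (Fin MR) (Fin d) ℂ),
    (∀ j i, i ≠ j → (U j)ᴴ * channelMatrix h j i * V i = 0) ∧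
    (∀ k, ((U k)ᴴ * channelMatrix h k k * V k).rank = d)

/-- The individual laws `μ e` of the channel coefficients are continuous probability
distributions on `ℂ`, i.e. no single value has positive probability. -/
def IsContinuousLaw {MT MR : ℕ} (μ : CoeffIndex MT MR → Measure ℂ) : Prop :=
  ∀ e, IsProbabilityMeasure (μ e) ∧ ∀ z : ℂ, μ e {z} = 0

/-- `d` streams per user are feasible: with independent channel coefficients of laws `μ e`, the
alignment problem is almost surely solvable. -/
def Feasible {MT MR : ℕ} (μ : CoeffIndex MT MR → Measure ℂ) (d : ℕ) : Prop :=
  ∀ᵐ h ∂(Measure.pi μ), AlignmentSolvable h d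

/-- `d` streams per user are infeasible: with independent channel coefficients of laws `μ e`, the
alignment problem almost surely has no solution. -/
def Infeasible {MT MR : ℕ} (μ : CoeffIndex MT MR → Measure ℂ) (d : ℕ) : Prop :=
  ∀ᵐ h ∂(Measure.pi μ), ¬ AlignmentSolvable h d

/-- The three-user system with `d` streams per user is proper: `d ≤ (M_T + M_R) / 4`. -/
def IsProper (MT MR d : ℕ) : Prop :=
  (d : ℚ) ≤ ((MT : ℚ) + (MR : ℚ)) / 4

/-- The ratio `M / N`, with `M = min M_T M_R` and `N = max M_T M_R`. -/
def antennaRatio (MT MR : ℕ) : ℚ :=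
  ((min MT MR : ℕ) : ℚ) / ((max MT MR : ℕ) : ℚ)

/-- The set `B = {1/3, 3/5, 5/7, …}`. -/
def ratioSetB : Set ℚ :=
  {γ | ∃ p : ℕ, 1 ≤ p ∧ γ = (2 * (p : ℚ) - 1) / (2 * (p : ℚ) + 1)}

/-! Transposing all channels exchanges transmitters and receivers, so let M = M_T ≤ N = M_R and δ =
N - M. The direct channels are independent of the cross channels and generically keep the streams
distinguishable, so only the nulling of interference by full-rank beams and filters matters
(`CrossAligned`).

Everything rests on alignment chains: beams x_0, ..., x_L from cyclically successive transmitters,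
x_r and x_{r+1} cancelling at the one receiver that both disturb. They form the kernel of a matrix T
with L N rows and (L+1) M columns. T generically has full rank: for one explicit channel the
equations read (x_r, 0) = (0, x_{r+1}), a shift by δ, whose kernel has dimension at most max(M - L
δ, 0); and a nonzero polynomial almost surely does not vanish at independent atomless coordinates.

Converse: aligned beams along a chain give an injection of C^{(L+1)d}, the filters a surjection onto
C^{Ld}, and filters ∘ T ∘ beams = 0. If T is onto (L = κ-1) this forces (2κ-1)d ≤ κM; if T is
injective (L = κ), (2κ+1)d ≤ κN. These are the two terms of DoF⋆.

Achievability for M < N: transmit c families of chains with d beams per transmitter in total. At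
each receiver one interferer spans d dimensions and the other adds only its c chain heads, so c + 2d
≤ N suffices; the two inequalities are what is needed to fit d beams into such chains
(`ae_alignmentSolvable_of_mul_le`). For M = N the alignment closes into a cycle, solved by an
invariant subspace.

Part 2 is arithmetic: at d = (M+N)/4 both bounds hold only if they are equalities, that is, if M/N =
(2κ-1)/(2κ+1). -/

/-! ### Almost sure statements for independent atomless coordinates -/

section Generic

variable {ι : Type*} [Fintype ι]

theorem ae_pi_reindex {ι' : Type*} [Fintype ι'] (μ : ι → Measure ℂ)
    [∀ i, IsProbabilityMeasure (μ i)] (f : ι' ≃ ι) {Q : (ι → ℂ) → Prop} :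
    (∀ᵐ h ∂Measure.pi μ, Q h) ↔ ∀ᵐ g ∂Measure.pi (fun i => μ (f i)), Q (g ∘ f.symm) := by
  have mp := measurePreserving_piCongrLeft μ f
  rw [← mp.map_eq, (MeasurableEquiv.measurableEmbedding _).ae_map_iff]
  have : ∀ g : ι' → ℂ, (MeasurableEquiv.piCongrLeft (fun _ => ℂ) f) g = g ∘ f.symm := by
    intro g
    funext i
    obtain ⟨j, rfl⟩ := f.surjective i
    rw [MeasurableEquiv.coe_piCongrLeft, Equiv.piCongrLeft_apply_apply]
    simp
  simp only [this]

/-- Induction on the variables with Fubini: almost surely the leading coefficient in the first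
variable survives specialization of the others, and then only finitely many values of that variable
are roots. Finite sets being null is all that is used; no density is needed. -/
theorem ae_eval_ne_zero_fin {n : ℕ} (μ : Fin n → Measure ℂ) [∀ i, IsProbabilityMeasure (μ i)]
    [∀ i, NullSingletonClass (μ i)] {p : MvPolynomial (Fin n) ℂ} (hp : p ≠ 0) :
    ∀ᵐ h ∂Measure.pi μ, MvPolynomial.eval h p ≠ 0 := by
  induction n with
  | zero =>
    have : ∃ h, MvPolynomial.eval h p ≠ 0 := by
      by_contra! hc
      exact hp (MvPolynomial.funext fun x => by simp [hc x])
    obtain ⟨h, hh⟩ := this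
    exact Filter.Eventually.of_forall fun g => by rwa [Subsingleton.elim g h]
  | succ n ih =>
    have mp := (measurePreserving_piFinSuccAbove μ 0).symm
    rw [← mp.map_eq, (MeasurableEquiv.measurableEmbedding _).ae_map_iff]
    have hcons : ∀ z : ℂ × (Fin n → ℂ),
        (MeasurableEquiv.piFinSuccAbove (fun _ => ℂ) 0).symm z = Fin.cons z.1 z.2 := by
      intro z
      simp [MeasurableEquiv.piFinSuccAbove, Fin.insertNthEquiv]
    simp only [hcons]
    have hmeas : MeasurableSet {z : ℂ × (Fin n → ℂ) |
        MvPolynomial.eval (Fin.cons z.1 z.2 : Fin (n + 1) → ℂ) p ≠ 0} := by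
      apply IsOpen.measurableSet
      apply isOpen_ne_fun _ continuous_const
      exact (MvPolynomial.continuous_eval p).comp 
        (Continuous.finCons (A := fun _ => ℂ) continuous_fst continuous_snd)
    rw [Measure.ae_prod_iff_ae_ae hmeas, Measure.ae_ae_comm hmeas]
    have hf : MvPolynomial.finSuccEquiv ℂ n p ≠ 0 := by simpa using hp
    have hc := Polynomial.leadingCoeff_ne_zero.mpr hf
    filter_upwards [ih (fun j => μ ((0 : Fin (n + 1)).succAbove j)) hc] with s hs
    have hq : Polynomial.map (MvPolynomial.eval s) (MvPolynomial.finSuccEquiv ℂ n p) ≠ 0 := by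
      intro h0
      apply hs
      have := congrArg (fun q => Polynomial.coeff q
        (MvPolynomial.finSuccEquiv ℂ n p).natDegree) h0
      simpa [Polynomial.coeff_map] using this
    have hfin := (Polynomial.finite_setOfPred_isRoot hq).countable.measure_zero (μ 0)
    rw [ae_iff]
    refine measure_mono_null ?_ hfin
    intro y hy
    simp only [ne_eq, not_not, Set.mem_ofPred_eq] at hy ⊢
    rwa [MvPolynomial.eval_eq_eval_mv_eval'] at hy

/-- A nonzero polynomial is almost surely nonzero at a point with independent atomless
coordinates. -/
theorem ae_eval_ne_zero (μ : ι → Measure ℂ) [∀ i, IsProbabilityMeasure (μ i)]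
    [∀ i, NullSingletonClass (μ i)] {p : MvPolynomial ι ℂ} (hp : p ≠ 0) :
    ∀ᵐ h ∂Measure.pi μ, MvPolynomial.eval h p ≠ 0 := by
  let f := (Fintype.equivFin ι).symm
  rw [ae_pi_reindex μ f]
  have hr : MvPolynomial.rename f.symm p ≠ 0 := by
    simpa using (map_ne_zero_iff _ (MvPolynomial.rename_injective _ f.symm.injective)).mpr hp
  filter_upwards [ae_eval_ne_zero_fin (fun i => μ (f i)) hr] with g hg
  rwa [MvPolynomial.eval_rename] at hg

/-- Resampling the coordinates in `p` preserves almost sure statements. -/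
theorem ae_of_ae_resample (μ : ι → Measure ℂ) [∀ i, IsProbabilityMeasure (μ i)]
    (p : ι → Prop) [DecidablePred p] {S : Set (ι → ℂ)} (hS : MeasurableSet S)
    (h : ∀ᵐ h ∂Measure.pi μ, ∀ᵐ x ∂Measure.pi (fun i : {i // p i} => μ i),
      (fun i => if hi : p i then x ⟨i, hi⟩ else h i) ∈ S) :
    ∀ᵐ h ∂Measure.pi μ, h ∈ S := by
  set e := MeasurableEquiv.piEquivPiSubtypeProd (fun _ : ι => ℂ) p with he
  have mp := (measurePreserving_piEquivPiSubtypeProd μ p).symm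
  rw [← mp.map_eq, (MeasurableEquiv.measurableEmbedding _).ae_map_iff] at h ⊢
  have hS' : MeasurableSet {z : _ × _ | e.symm (z.1, z.2) ∈ S} := e.symm.measurable hS
  rw [Measure.ae_prod_iff_ae_ae (e.symm.measurable hS), Measure.ae_ae_comm hS']
  -- The resampled point does not depend on the old `p`-coordinates, so these can be frozen at one
  -- good value.
  obtain ⟨x₀, hx₀⟩ := (Measure.ae_ae_of_ae_prod h).exists
  filter_upwards [hx₀] with y hy
  filter_upwards [hy] with x hx
  convert hx using 1
  funext i
  by_cases hi : p i
  · simp [he, hi, MeasurableEquiv.piEquivPiSubtypeProd, Equiv.piEquivPiSubtypeProd]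
  · simp [he, hi, MeasurableEquiv.piEquivPiSubtypeProd, Equiv.piEquivPiSubtypeProd]

/-- An open set is a countable union of closed sets, and closed sets here are σ-compact, so the
projection is a countable union of compact sets. This supplies the measurability that Fubini needs
for an existential condition. -/
theorem measurableSet_image_fst_inter {X Y : Type*} [PseudoEMetricSpace X] [PseudoEMetricSpace Y]
    [SigmaCompactSpace X] [SigmaCompactSpace Y] [T2Space X] [MeasurableSpace X] [BorelSpace X]
    {C O : Set (X × Y)} (hC : IsClosed C) (hO : IsOpen O) :
    MeasurableSet (Prod.fst '' (C ∩ O)) := by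
  obtain ⟨F, hF, -, hU, -⟩ := hO.exists_iUnion_isClosed
  rw [← hU, Set.inter_iUnion, Set.image_iUnion]
  refine MeasurableSet.iUnion fun n => ?_
  have : IsSigmaCompact (Prod.fst '' (C ∩ F n)) :=
    (isSigmaCompact_univ.of_isClosed_subset (hC.inter (hF n)) (Set.subset_univ _)).image
      continuous_fst
  obtain ⟨K, hK, hKU⟩ := this
  rw [← hKU]
  exact MeasurableSet.iUnion fun m => (hK m).measurableSet

end Generic

/-! ### Solvability as a polynomial condition, and removal of the direct channels -/

theorem Matrix.det_ne_zero_of_rank_eq {d : ℕ} {A : Matrix (Fin d) (Fin d) ℂ} (h : A.rank = d) :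
    A.det ≠ 0 := by
  have htop : A.mulVecLin.range = ⊤ := by
    apply Submodule.eq_top_of_finrank_eq
    rw [← Matrix.rank, h]
    simp
  have hs : Function.Surjective A.mulVec := LinearMap.range_eq_top.mp htop
  exact ((Matrix.isUnit_iff_isUnit_det A).mp (Matrix.mulVec_surjective_iff_isUnit.mp hs)).ne_zero

/-- Without conjugation and rank, the conditions are polynomial equations and inequations in the
channels, beams and filters. -/
theorem alignmentSolvable_iff {MT MR : ℕ} (h : CoeffIndex MT MR → ℂ) (d : ℕ) :
    AlignmentSolvable h d ↔
      ∃ (V : Fin 3 → Matrix (Fin MT) (Fin d) ℂ) (W : Fin 3 → Matrix (Fin d) (Fin MR) ℂ),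
        (∀ j i, i ≠ j → W j * channelMatrix h j i * V i = 0) ∧
        (∀ k, (W k * channelMatrix h k k * V k).det ≠ 0) := by
  constructor
  · rintro ⟨V, U, h1, h2⟩
    exact ⟨V, fun j => (U j)ᴴ, h1, fun k => Matrix.det_ne_zero_of_rank_eq (h2 k)⟩
  · rintro ⟨V, W, h1, h2⟩
    refine ⟨V, fun j => (W j)ᴴ, fun j i hij => ?_, fun k => ?_⟩
    · simpa using h1 j i hij
    · have hu : IsUnit (W k * channelMatrix h k k * V k) :=
        (Matrix.isUnit_iff_isUnit_det _).mpr (h2 k).isUnit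
      simpa using Matrix.rank_of_isUnit _ hu

theorem measurableSet_alignmentSolvable (MT MR d : ℕ) :
    MeasurableSet {h : CoeffIndex MT MR → ℂ | AlignmentSolvable h d} := by
  let P : Fin 3 → Fin 3 → (CoeffIndex MT MR → ℂ) ×
      (Fin 3 → Fin MT → Fin d → ℂ) × (Fin 3 → Fin d → Fin MR → ℂ) → Matrix (Fin d) (Fin d) ℂ := fun j i z =>
    Matrix.of (z.2.2 j) * channelMatrix z.1 j i * Matrix.of (z.2.1 i)
  have hP : ∀ j i, Continuous (P j i) := by
    intro j i
    refine Continuous.matrix_mul (Continuous.matrix_mul ?_ ?_) ?_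
    · refine continuous_matrix fun a b => ?_
      simp only [Matrix.of_apply]
      fun_prop
    · refine continuous_matrix fun a b => ?_
      simp only [channelMatrix, Matrix.of_apply]
      fun_prop
    · refine continuous_matrix fun a b => ?_
      simp only [Matrix.of_apply]
      fun_prop
  have hC : IsClosed {z | ∀ j i, i ≠ j → P j i z = 0} := by
    simp only [Set.ofPred_forall]
    exact isClosed_iInter fun j => isClosed_iInter fun i => isClosed_iInter fun _ =>
      isClosed_eq (hP j i) continuous_const
  have hO : IsOpen {z | ∀ k, (P k k z).det ≠ 0} := by
    simp only [Set.ofPred_forall]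
    exact isOpen_iInter_of_finite fun k => isOpen_ne_fun (hP k k).matrix_det continuous_const
  convert measurableSet_image_fst_inter hC hO using 1
  ext h
  simp only [Set.mem_ofPred_eq, alignmentSolvable_iff, Set.mem_image, Set.mem_inter_iff]
  constructor
  · rintro ⟨V, W, h1, h2⟩
    exact ⟨⟨h, V, W⟩, ⟨h1, h2⟩, rfl⟩
  · rintro ⟨⟨h, V, W⟩, ⟨h1, h2⟩, rfl⟩
    exact ⟨V, W, h1, h2⟩

/-- Interference can be nulled by beamformers of full rank. -/
def CrossAligned {MT MR : ℕ} (h : CoeffIndex MT MR → ℂ) (d : ℕ) : Prop :=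
  ∃ (V : Fin 3 → Matrix (Fin MT) (Fin d) ℂ) (W : Fin 3 → Matrix (Fin d) (Fin MR) ℂ),
    (∀ j i, i ≠ j → W j * channelMatrix h j i * V i = 0) ∧
    (∀ i, ∃ L : Matrix (Fin d) (Fin MT) ℂ, L * V i = 1) ∧
    (∀ j, ∃ R : Matrix (Fin MR) (Fin d) ℂ, W j * R = 1)

theorem AlignmentSolvable.crossAligned {MT MR : ℕ} {h : CoeffIndex MT MR → ℂ} {d : ℕ}
    (hs : AlignmentSolvable h d) : CrossAligned h d := by
  obtain ⟨V, W, h1, h2⟩ := (alignmentSolvable_iff h d).mp hs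
  refine ⟨V, W, h1, fun i => ?_, fun j => ?_⟩
  · refine ⟨(W i * channelMatrix h i i * V i)⁻¹ * (W i * channelMatrix h i i), ?_⟩
    rw [Matrix.mul_assoc, Matrix.nonsing_inv_mul _ (h2 i).isUnit]
  · refine ⟨channelMatrix h j j * V j * (W j * channelMatrix h j j * V j)⁻¹, ?_⟩
    rw [← Matrix.mul_assoc, ← Matrix.mul_assoc, Matrix.mul_nonsing_inv _ (h2 j).isUnit]

theorem map_eval_map_C {ι m n : Type*} (h : ι → ℂ) (A : Matrix m n ℂ) :
    (A.map (MvPolynomial.C (σ := ι))).map (MvPolynomial.eval h) = A := by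
  ext a b
  simp

/-- A square matrix of polynomials that is nonsingular somewhere is almost surely nonsingular. -/
theorem ae_det_map_eval_ne_zero {ι k : Type*} [Fintype ι] [Fintype k] [DecidableEq k]
    (μ : ι → Measure ℂ) [∀ i, IsProbabilityMeasure (μ i)] [∀ i, NullSingletonClass (μ i)]
    (D : Matrix k k (MvPolynomial ι ℂ)) {h₀ : ι → ℂ}
    (h0 : (D.map (MvPolynomial.eval h₀)).det ≠ 0) :
    ∀ᵐ h ∂Measure.pi μ, (D.map (MvPolynomial.eval h)).det ≠ 0 := by
  have hdet : ∀ h, (D.map (MvPolynomial.eval h)).det = MvPolynomial.eval h D.det := fun h =>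
    (RingHom.map_det (MvPolynomial.eval h) D).symm
  have hD : D.det ≠ 0 := by
    intro hD
    rw [hdet, hD, map_zero] at h0
    exact h0 rfl
  filter_upwards [ae_eval_ne_zero μ hD] with h hh
  rwa [hdet]

/-- Once the interference can be nulled, generic direct channels keep the streams
distinguishable. -/
theorem ae_alignmentSolvable_of_ae_crossAligned {MT MR d : ℕ} (μ : CoeffIndex MT MR → Measure ℂ)
    [∀ i, IsProbabilityMeasure (μ i)] [∀ i, NullSingletonClass (μ i)]
    (hc : ∀ᵐ h ∂Measure.pi μ, CrossAligned h d) :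
    ∀ᵐ h ∂Measure.pi μ, AlignmentSolvable h d := by
  refine ae_of_ae_resample μ (fun e => e.1 = e.2.1) (measurableSet_alignmentSolvable MT MR d) ?_
  filter_upwards [hc] with h hh
  obtain ⟨V, W, h1, h2, h3⟩ := hh
  choose L hL using h2
  choose R hR using h3
  let I := {e : CoeffIndex MT MR // e.1 = e.2.1}
  let X : ∀ k : Fin 3, Matrix (Fin MR) (Fin MT) (MvPolynomial I ℂ) :=
    fun k => Matrix.of fun b a => MvPolynomial.X ⟨(k, k, b, a), rfl⟩
  let G : (I → ℂ) → Fin 3 → Matrix (Fin MR) (Fin MT) ℂ :=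
    fun x k => Matrix.of fun b a => x ⟨(k, k, b, a), rfl⟩
  have hX : ∀ (k : Fin 3) (x : I → ℂ),
      ((W k).map (MvPolynomial.C (σ := I)) * X k * (V k).map (MvPolynomial.C (σ := I))).map
        (MvPolynomial.eval x) = W k * G x k * V k := by
    intro k x
    rw [Matrix.map_mul, Matrix.map_mul, map_eval_map_C, map_eval_map_C]
    congr 2
    ext b a
    simp [X, G]
  have hgen : ∀ᵐ x ∂Measure.pi (fun e : I => μ e), ∀ k, (W k * G x k * V k).det ≠ 0 := by
    rw [ae_all_iff]
    intro k
    simp only [← hX]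
    -- At the direct channel `R k * L k` the product is the identity, so the determinant is not the
    -- zero polynomial.
    apply ae_det_map_eval_ne_zero _ _
      (h₀ := fun e => (R e.1.1 * L e.1.1) e.1.2.2.1 e.1.2.2.2)
    rw [hX]
    have : W k * (R k * L k) * V k = 1 := by
      rw [← Matrix.mul_assoc, hR, Matrix.one_mul, hL]
    change (W k * (R k * L k) * V k).det ≠ 0
    rw [this, Matrix.det_one]
    exact one_ne_zero
  filter_upwards [hgen] with x hx
  refine (alignmentSolvable_iff _ d).mpr ⟨V, W, fun j i hij => ?_, fun k => ?_⟩
  · convert h1 j i hij using 3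
    ext b a
    simp [channelMatrix, hij.symm]
  · convert hx k using 4
    ext b a
    simp [channelMatrix, G]

/-! ### Duality between transmitters and receivers -/

/-- Coefficient relabelling which exchanges the roles of transmitters and receivers. -/
def swapIndex (MT MR : ℕ) : CoeffIndex MR MT ≃ CoeffIndex MT MR where
  toFun e := (e.2.1, e.1, e.2.2.2, e.2.2.1)
  invFun e := (e.2.1, e.1, e.2.2.2, e.2.2.1)
  left_inv _ := rfl
  right_inv _ := rfl

theorem AlignmentSolvable.swap {MT MR d : ℕ} {h : CoeffIndex MT MR → ℂ}
    (hs : AlignmentSolvable h d) : AlignmentSolvable (h ∘ swapIndex MT MR) d := by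
  rw [alignmentSolvable_iff] at hs ⊢
  obtain ⟨V, W, h1, h2⟩ := hs
  have hT : ∀ j i, channelMatrix (h ∘ swapIndex MT MR) j i = (channelMatrix h i j)ᵀ :=
    fun j i => rfl
  refine ⟨fun i => (W i)ᵀ, fun j => (V j)ᵀ, fun j i hij => ?_, fun k => ?_⟩
  · rw [hT, ← Matrix.transpose_mul, ← Matrix.transpose_mul, ← Matrix.mul_assoc,
      h1 i j hij.symm, Matrix.transpose_zero]
  · rw [hT, ← Matrix.transpose_mul, ← Matrix.transpose_mul, ← Matrix.mul_assoc,
      Matrix.det_transpose]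
    exact h2 k

theorem alignmentSolvable_swap_iff {MT MR d : ℕ} {h : CoeffIndex MT MR → ℂ} :
    AlignmentSolvable (h ∘ swapIndex MT MR) d ↔ AlignmentSolvable h d :=
  ⟨fun hs => hs.swap, fun hs => hs.swap⟩

theorem feasible_swap_iff {MT MR d : ℕ} (μ : CoeffIndex MT MR → Measure ℂ)
    [∀ i, IsProbabilityMeasure (μ i)] :
    Feasible (fun e => μ (swapIndex MT MR e)) d ↔ Feasible μ d := by
  unfold Feasible
  rw [ae_pi_reindex μ (swapIndex MT MR)]
  exact Filter.eventually_congr <| .of_forall fun g =>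
    (alignmentSolvable_swap_iff (MT := MR) (MR := MT)).symm

theorem infeasible_swap_iff {MT MR d : ℕ} (μ : CoeffIndex MT MR → Measure ℂ)
    [∀ i, IsProbabilityMeasure (μ i)] :
    Infeasible (fun e => μ (swapIndex MT MR e)) d ↔ Infeasible μ d := by
  unfold Infeasible
  rw [ae_pi_reindex μ (swapIndex MT MR)]
  exact Filter.eventually_congr <| .of_forall fun g =>
    not_congr (alignmentSolvable_swap_iff (MT := MR) (MR := MT)).symm

/-! ### Alignment chains and their generic rank -/

/-- The `r`-th transmitter visited by an alignment chain which starts at transmitter `s`. -/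
def chainTx (s : Fin 3) (r : ℕ) : Fin 3 := s + r • (1 : Fin 3)

theorem chainTx_succ (s : Fin 3) (r : ℕ) : chainTx s (r + 1) = chainTx s r + 1 := by
  rw [chainTx, chainTx, succ_nsmul, add_assoc]

/-- The linear system for alignment chains of `L + 1` beams starting at transmitter `s`: beams `r`
and `r + 1` cancel at the one receiver interfered by both of their transmitters. -/
def chainMatrix {R : Type*} [CommRing R] {M N : ℕ}
    (F : Fin 3 → Fin 3 → Matrix (Fin N) (Fin M) R) (s : Fin 3) (L : ℕ) :
    Matrix (Fin L × Fin N) (Fin (L + 1) × Fin M) R :=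
  Matrix.of fun p q =>
    (if q.1 = p.1.castSucc then F (chainTx s p.1 + 2) (chainTx s p.1) p.2 q.2 else 0) +
    (if q.1 = p.1.succ then F (chainTx s p.1 + 2) (chainTx s p.1 + 1) p.2 q.2 else 0)

theorem chainMatrix_mulVec {R : Type*} [CommRing R] {M N : ℕ}
    (F : Fin 3 → Fin 3 → Matrix (Fin N) (Fin M) R) (s : Fin 3) (L : ℕ)
    (x : Fin (L + 1) × Fin M → R) (r : Fin L) (b : Fin N) :
    (chainMatrix F s L *ᵥ x) (r, b) =
      (F (chainTx s r + 2) (chainTx s r) *ᵥ fun a => x (r.castSucc, a)) b +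
      (F (chainTx s r + 2) (chainTx s r + 1) *ᵥ fun a => x (r.succ, a)) b := by
  simp only [Matrix.mulVec, dotProduct, chainMatrix, Matrix.of_apply, Fintype.sum_prod_type,
    add_mul, Finset.sum_add_distrib]
  congr 1
  · rw [Finset.sum_eq_single r.castSucc]
    · simp
    · intro i _ hi
      simp [hi]
    · simp
  · rw [Finset.sum_eq_single r.succ]
    · simp
    · intro i _ hi
      simp [hi]
    · simp

theorem chainMatrix_map {R S : Type*} [CommRing R] [CommRing S] (φ : R →+* S) {M N : ℕ}
    (F : Fin 3 → Fin 3 → Matrix (Fin N) (Fin M) R) (s : Fin 3) (L : ℕ) :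
    (chainMatrix F s L).map φ = chainMatrix (fun j i => (F j i).map φ) s L := by
  ext p q
  simp only [chainMatrix, Matrix.map_apply, Matrix.of_apply, map_add]
  split_ifs <;> simp

/-- The channel matrices with indeterminate entries. -/
noncomputable def genericChannel (M N : ℕ) (j i : Fin 3) :
    Matrix (Fin N) (Fin M) (MvPolynomial (CoeffIndex M N) ℂ) :=
  Matrix.of fun b a => MvPolynomial.X (j, i, b, a)

theorem genericChannel_map_eval {M N : ℕ} (h : CoeffIndex M N → ℂ) (j i : Fin 3) :
    (genericChannel M N j i).map (MvPolynomial.eval h) = channelMatrix h j i := by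
  ext b a
  simp [genericChannel, channelMatrix]

theorem chainMatrix_genericChannel_map_eval {M N : ℕ} (h : CoeffIndex M N → ℂ) (s : Fin 3)
    (L : ℕ) : (chainMatrix (genericChannel M N) s L).map (MvPolynomial.eval h) =
      chainMatrix (channelMatrix h) s L := by
  rw [chainMatrix_map]
  simp only [genericChannel_map_eval]

/-- The channel realization in which receiver `j` sees transmitter `j + 1` on its first antennas
and all other transmitters, up to sign, on its last antennas. -/
def shiftCoeff (M N : ℕ) : CoeffIndex M N → ℂ := fun e =>
  if e.2.1 = e.1 + 1 then (if (e.2.2.1 : ℕ) = e.2.2.2 then 1 else 0)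
  else (if (e.2.2.1 : ℕ) = e.2.2.2 + (N - M) then -1 else 0)

theorem channelMatrix_shiftCoeff_mulVec_left {M N : ℕ} (t : Fin 3) (x : Fin M → ℂ)
    (b : Fin N) : (channelMatrix (shiftCoeff M N) (t + 2) t *ᵥ x) b =
      if h : (b : ℕ) < M then x ⟨b, h⟩ else 0 := by
  have ht : t = t + 2 + 1 := by revert t; decide
  simp only [Matrix.mulVec, dotProduct, channelMatrix, shiftCoeff, Matrix.of_apply, ← ht,
    if_true]
  split_ifs with h
  · rw [Finset.sum_eq_single ⟨b, h⟩]
    · simp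
    · intro a _ ha
      rw [if_neg, zero_mul]
      rintro hb
      exact ha (Fin.ext hb.symm)
    · simp
  · apply Finset.sum_eq_zero
    intro a _
    rw [if_neg, zero_mul]
    omega

theorem channelMatrix_shiftCoeff_mulVec_right {M N : ℕ} (hMN : M ≤ N) (t : Fin 3)
    (x : Fin M → ℂ) (b : Fin N) :
    (channelMatrix (shiftCoeff M N) (t + 2) (t + 1) *ᵥ x) b =
      - if h : N - M ≤ b then x ⟨b - (N - M), by omega⟩ else 0 := by
  have ht : t + 1 ≠ t + 2 + 1 := by revert t; decide
  simp only [Matrix.mulVec, dotProduct, channelMatrix, shiftCoeff, Matrix.of_apply, ht,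
    if_false]
  split_ifs with h
  · rw [Finset.sum_eq_single ⟨b - (N - M), by omega⟩]
    · simp only
      rw [if_pos (by omega), neg_one_mul]
    · intro a _ ha
      rw [if_neg, zero_mul]
      rintro hb
      exact ha (Fin.ext (by simp only; omega))
    · simp
  · rw [neg_zero]
    apply Finset.sum_eq_zero
    intro a _
    rw [if_neg, zero_mul]
    omega

section ShiftKernel

variable {M N : ℕ} {s : Fin 3} {L : ℕ} {x : Fin (L + 1) × Fin M → ℂ}

theorem shift_kernel_eq (hMN : M ≤ N)
    (hx : chainMatrix (channelMatrix (shiftCoeff M N)) s L *ᵥ x = 0) (r : Fin L) (b : Fin N) :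
    (if h : (b : ℕ) < M then x (r.castSucc, ⟨b, h⟩) else 0) =
      if h : N - M ≤ b then x (r.succ, ⟨b - (N - M), by omega⟩) else 0 := by
  have h := congrFun hx (r, b)
  rw [chainMatrix_mulVec, channelMatrix_shiftCoeff_mulVec_left,
    channelMatrix_shiftCoeff_mulVec_right hMN, Pi.zero_apply, add_neg_eq_zero] at h
  exact h

/-- Each link moves the support down by δ = N - M, so the `r`-th beam can only live on the first M -
rδ coordinates. -/
theorem shift_kernel_eq_zero_of_le (hMN : M ≤ N)
    (hx : chainMatrix (channelMatrix (shiftCoeff M N)) s L *ᵥ x = 0) :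
    ∀ (r : ℕ) (hr : r < L + 1) (a : Fin M), M ≤ a + r * (N - M) → x (⟨r, hr⟩, a) = 0 := by
  intro r
  induction r with
  | zero =>
    intro hr a ha
    omega
  | succ r ih =>
    intro hr a ha
    have h := shift_kernel_eq hMN hx ⟨r, by omega⟩ ⟨a + (N - M), by omega⟩
    simp only [le_add_iff_nonneg_left, zero_le, dif_pos, add_tsub_cancel_right, Fin.succ_mk,
      Fin.eta, Fin.castSucc_mk] at h
    rw [← h]
    split_ifs with hlt
    · apply ih
      simp only
      rw [add_mul] at ha
      omega
    · rfl

/-- Every beam is a shifted copy of its successor, so the last beam determines the chain. -/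
theorem shift_kernel_eq_zero (hMN : M ≤ N)
    (hx : chainMatrix (channelMatrix (shiftCoeff M N)) s L *ᵥ x = 0)
    (h0 : ∀ a, x (Fin.last L, a) = 0) : x = 0 := by
  have key : ∀ r : Fin (L + 1), ∀ a, x (r, a) = 0 := by
    intro r
    induction r using Fin.reverseInduction with
    | last => exact h0
    | cast r ih =>
      intro a
      have h := shift_kernel_eq hMN hx r ⟨a, by omega⟩
      simp only [a.2, dif_pos, Fin.eta] at h
      rw [h]
      split_ifs
      · exact ih _
      · rfl
  funext p
  exact key p.1 p.2

/-- The last beam determines the chain and is supported on M - Lδ coordinates. The truncated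
subtraction covers long chains, whose kernel is zero. -/
theorem finrank_ker_chainMatrix_shiftCoeff_le (hMN : M ≤ N) (s : Fin 3) (L : ℕ) :
    Module.finrank ℂ (chainMatrix (channelMatrix (shiftCoeff M N)) s L).mulVecLin.ker ≤
      M - L * (N - M) := by
  let T := chainMatrix (channelMatrix (shiftCoeff M N)) s L
  let g : (Fin (L + 1) × Fin M → ℂ) →ₗ[ℂ] (Fin (M - L * (N - M)) → ℂ) :=
    LinearMap.funLeft ℂ ℂ fun a => (Fin.last L, ⟨a, by omega⟩)
  have hinj : Function.Injective (g ∘ₗ T.mulVecLin.ker.subtype) := by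
    rw [← LinearMap.ker_eq_bot, LinearMap.ker_eq_bot']
    rintro ⟨x, hx⟩ hg
    have hx' : T *ᵥ x = 0 := hx
    ext1
    apply shift_kernel_eq_zero hMN hx'
    intro a
    by_cases ha : M ≤ a + L * (N - M)
    · exact shift_kernel_eq_zero_of_le hMN hx' L (by omega) a ha
    · exact congrFun hg ⟨a, by omega⟩
  simpa using LinearMap.finrank_le_finrank_of_injective hinj

end ShiftKernel

theorem chainMatrix_shiftCoeff_surjective {M N L : ℕ} (hMN : M ≤ N) (hL : L * (N - M) ≤ M)
    (s : Fin 3) :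
    Function.Surjective (chainMatrix (channelMatrix (shiftCoeff M N)) s L).mulVec := by
  set T := chainMatrix (channelMatrix (shiftCoeff M N)) s L
  have h1 : Module.finrank ℂ T.mulVecLin.ker ≤ M - L * (N - M) :=
    finrank_ker_chainMatrix_shiftCoeff_le hMN s L
  have h2 := LinearMap.finrank_range_add_finrank_ker T.mulVecLin
  have h3 : T.mulVecLin.range = ⊤ := by
    apply Submodule.eq_top_of_finrank_eq
    apply le_antisymm (Submodule.finrank_le _)
    rw [Module.finrank_fintype_fun_eq_card] at h2 ⊢
    simp only [Fintype.card_prod, Fintype.card_fin] at h2 ⊢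
    have : L * N = L * (N - M) + L * M := by rw [← mul_add, Nat.sub_add_cancel hMN]
    rw [add_mul] at h2
    omega
  exact LinearMap.range_eq_top.mp h3

theorem chainMatrix_shiftCoeff_injective {M N L : ℕ} (hMN : M ≤ N) (hL : M ≤ L * (N - M))
    (s : Fin 3) :
    Function.Injective (chainMatrix (channelMatrix (shiftCoeff M N)) s L).mulVec := by
  have h1 := finrank_ker_chainMatrix_shiftCoeff_le hMN s L
  rw [Nat.sub_eq_zero_of_le hL, Nat.le_zero, Submodule.finrank_eq_zero] at h1
  exact LinearMap.ker_eq_bot.mp h1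

theorem Matrix.exists_left_inverse_of_mulVec_injective {m n : Type*} [Fintype m] [Fintype n]
    [DecidableEq m] [DecidableEq n] {A : Matrix m n ℂ} (hA : Function.Injective A.mulVec) :
    ∃ B : Matrix n m ℂ, B * A = 1 := by
  obtain ⟨g, hg⟩ := LinearMap.exists_leftInverse_of_injective (Matrix.toLin' A)
    (LinearMap.ker_eq_bot.mpr hA)
  refine ⟨LinearMap.toMatrix' g, ?_⟩
  have := congrArg LinearMap.toMatrix' hg
  rwa [LinearMap.toMatrix'_comp, LinearMap.toMatrix'_id, LinearMap.toMatrix'_toLin'] at this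

theorem Matrix.mulVec_injective_of_left_inverse {m n : Type*} [Fintype m] [Fintype n]
    [DecidableEq n] {A : Matrix m n ℂ} {B : Matrix n m ℂ} (h : B * A = 1) :
    Function.Injective A.mulVec := by
  intro x y hxy
  have := congrArg (B *ᵥ ·) hxy
  simpa [Matrix.mulVec_mulVec, h] using this

/-- A matrix of polynomials with a left inverse at one point is almost surely left invertible. -/
theorem ae_exists_left_inverse {ι m n : Type*} [Fintype ι] [Fintype m] [Fintype n]
    [DecidableEq n]
    (μ : ι → Measure ℂ) [∀ i, IsProbabilityMeasure (μ i)] [∀ i, NullSingletonClass (μ i)]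
    (A : Matrix m n (MvPolynomial ι ℂ)) {h₀ : ι → ℂ} {B : Matrix n m ℂ}
    (h0 : B * A.map (MvPolynomial.eval h₀) = 1) :
    ∀ᵐ h ∂Measure.pi μ, ∃ B' : Matrix n m ℂ, B' * A.map (MvPolynomial.eval h) = 1 := by
  have key : ∀ h, (B.map (MvPolynomial.C (σ := ι)) * A).map (MvPolynomial.eval h) =
      B * A.map (MvPolynomial.eval h) := fun h => by rw [Matrix.map_mul, map_eval_map_C]
  -- Freezing the left inverse `B` found at `h₀` gives a square polynomial matrix with determinant 1
  -- there, which avoids choosing a minor.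
  have := ae_det_map_eval_ne_zero μ (B.map (MvPolynomial.C (σ := ι)) * A) (h₀ := h₀)
    (by rw [key, h0, Matrix.det_one]; exact one_ne_zero)
  filter_upwards [this] with h hh
  rw [key] at hh
  exact ⟨(B * A.map (MvPolynomial.eval h))⁻¹ * B, by
    rw [Matrix.mul_assoc, Matrix.nonsing_inv_mul _ hh.isUnit]⟩

theorem ae_exists_right_inverse {ι m n : Type*} [Fintype ι] [Fintype m] [Fintype n]
    [DecidableEq m]
    (μ : ι → Measure ℂ) [∀ i, IsProbabilityMeasure (μ i)] [∀ i, NullSingletonClass (μ i)]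
    (A : Matrix m n (MvPolynomial ι ℂ)) {h₀ : ι → ℂ} {B : Matrix n m ℂ}
    (h0 : A.map (MvPolynomial.eval h₀) * B = 1) :
    ∀ᵐ h ∂Measure.pi μ, ∃ B' : Matrix n m ℂ, A.map (MvPolynomial.eval h) * B' = 1 := by
  have h1 : Bᵀ * Aᵀ.map (MvPolynomial.eval h₀) = 1 := by
    rw [Matrix.transpose_map, ← Matrix.transpose_mul, h0, Matrix.transpose_one]
  filter_upwards [ae_exists_left_inverse μ Aᵀ h1] with h ⟨B', hB'⟩
  refine ⟨B'ᵀ, ?_⟩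
  rw [← Matrix.transpose_transpose (A.map _), ← Matrix.transpose_mul, ← Matrix.transpose_map, hB',
    Matrix.transpose_one]

section GenericRank

variable {M N : ℕ} (μ : CoeffIndex M N → Measure ℂ) [∀ i, IsProbabilityMeasure (μ i)]
  [∀ i, NullSingletonClass (μ i)]

theorem ae_chainMatrix_surjective {L : ℕ} (hMN : M ≤ N) (hL : L * (N - M) ≤ M) (s : Fin 3) :
    ∀ᵐ h ∂Measure.pi μ, Function.Surjective (chainMatrix (channelMatrix h) s L).mulVec := by
  obtain ⟨B, hB⟩ := Matrix.mulVec_surjective_iff_exists_right_inverse.mp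
    (chainMatrix_shiftCoeff_surjective hMN hL s)
  rw [← chainMatrix_genericChannel_map_eval] at hB
  filter_upwards [ae_exists_right_inverse μ _ hB] with h hh
  rw [chainMatrix_genericChannel_map_eval] at hh
  exact Matrix.mulVec_surjective_iff_exists_right_inverse.mpr hh

theorem ae_chainMatrix_injective {L : ℕ} (hMN : M ≤ N) (hL : M ≤ L * (N - M)) (s : Fin 3) :
    ∀ᵐ h ∂Measure.pi μ, Function.Injective (chainMatrix (channelMatrix h) s L).mulVec := by
  obtain ⟨B, hB⟩ := Matrix.exists_left_inverse_of_mulVec_injective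
    (chainMatrix_shiftCoeff_injective hMN hL s)
  rw [← chainMatrix_genericChannel_map_eval] at hB
  filter_upwards [ae_exists_left_inverse μ _ hB] with h ⟨B', hB'⟩
  rw [chainMatrix_genericChannel_map_eval] at hB'
  exact Matrix.mulVec_injective_of_left_inverse hB'

end GenericRank

/-! ### Converse: dimension count along a chain -/

theorem finrank_add_finrank_le_of_comp_eq_zero {W X Z : Type*} [AddCommGroup W] [Module ℂ W]
    [AddCommGroup X] [Module ℂ X] [FiniteDimensional ℂ X] [AddCommGroup Z] [Module ℂ Z] {α : W →ₗ[ℂ] X} {γ : X →ₗ[ℂ] Z}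
    (hα : Function.Injective α) (hγ : Function.Surjective γ) (h : γ ∘ₗ α = 0) :
    Module.finrank ℂ W + Module.finrank ℂ Z ≤ Module.finrank ℂ X := by
  have h1 := LinearMap.finrank_range_add_finrank_ker γ
  rw [LinearMap.range_eq_top.mpr hγ, finrank_top] at h1
  have h2 : α.range ≤ γ.ker := LinearMap.range_le_ker_iff.mpr h
  have h3 := Submodule.finrank_mono h2
  rw [LinearMap.finrank_range_of_inj hα] at h3
  omega

section Converse

variable {M N d : ℕ}

/-- The chain of transmit beams, as a linear map in their coordinates. -/
def chainBeams (V : Fin 3 → Matrix (Fin M) (Fin d) ℂ) (s : Fin 3) (L : ℕ) :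
    (Fin (L + 1) → Fin d → ℂ) →ₗ[ℂ] (Fin (L + 1) × Fin M → ℂ) where
  toFun y q := (V (chainTx s q.1) *ᵥ y q.1) q.2
  map_add' y z := by
    funext q
    simp [Matrix.mulVec_add]
  map_smul' c y := by
    funext q
    simp [Matrix.mulVec_smul]

/-- The zero-forcing filters of the receivers along a chain. -/
def chainFilters (W : Fin 3 → Matrix (Fin d) (Fin N) ℂ) (s : Fin 3) (L : ℕ) :
    (Fin L × Fin N → ℂ) →ₗ[ℂ] (Fin L → Fin d → ℂ) where
  toFun z r := W (chainTx s r + 2) *ᵥ fun b => z (r, b)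
  map_add' y z := by
    funext r
    rw [Pi.add_apply, ← Matrix.mulVec_add]
    rfl
  map_smul' c y := by
    funext r
    rw [Pi.smul_apply, RingHom.id_apply, ← Matrix.mulVec_smul]
    rfl

theorem chainBeams_injective {V : Fin 3 → Matrix (Fin M) (Fin d) ℂ}
    (hV : ∀ i, ∃ B : Matrix (Fin d) (Fin M) ℂ, B * V i = 1) (s : Fin 3) (L : ℕ) :
    Function.Injective (chainBeams V s L) := by
  intro y z hyz
  funext r
  obtain ⟨B, hB⟩ := hV (chainTx s r)
  apply Matrix.mulVec_injective_of_left_inverse hB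
  funext a
  exact congrFun hyz (r, a)

theorem chainFilters_surjective {W : Fin 3 → Matrix (Fin d) (Fin N) ℂ}
    (hW : ∀ j, ∃ B : Matrix (Fin N) (Fin d) ℂ, W j * B = 1) (s : Fin 3) (L : ℕ) :
    Function.Surjective (chainFilters W s L) := by
  intro y
  choose B hB using hW
  refine ⟨fun p => (B (chainTx s p.1 + 2) *ᵥ y p.1) p.2, ?_⟩
  funext r
  change W (chainTx s r + 2) *ᵥ (B (chainTx s r + 2) *ᵥ y r) = y r
  rw [Matrix.mulVec_mulVec, hB, Matrix.one_mulVec]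

/-- Row `r` of the chain matrix is received by the third user, for whom both transmitters of that
link are interferers; its filter nulls each of the two terms. -/
theorem chainFilters_chainMatrix_chainBeams {h : CoeffIndex M N → ℂ}
    {V : Fin 3 → Matrix (Fin M) (Fin d) ℂ} {W : Fin 3 → Matrix (Fin d) (Fin N) ℂ}
    (hVW : ∀ j i, i ≠ j → W j * channelMatrix h j i * V i = 0) (s : Fin 3) (L : ℕ) :
    chainFilters W s L ∘ₗ (chainMatrix (channelMatrix h) s L).mulVecLin ∘ₗ chainBeams V s L =
      0 := by
  refine LinearMap.ext fun y => funext fun r => ?_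
  have ht : ∀ t : Fin 3, t ≠ t + 2 ∧ t + 1 ≠ t + 2 := by decide
  have hz : (fun b => (chainMatrix (channelMatrix h) s L *ᵥ chainBeams V s L y) (r, b)) =
      channelMatrix h (chainTx s r + 2) (chainTx s r) *ᵥ
        (V (chainTx s r) *ᵥ y r.castSucc) +
      channelMatrix h (chainTx s r + 2) (chainTx s r + 1) *ᵥ
        (V (chainTx s r + 1) *ᵥ y r.succ) := by
    funext b
    rw [chainMatrix_mulVec, ← chainTx_succ]
    rfl
  change W (chainTx s r + 2) *ᵥ
    (fun b => (chainMatrix (channelMatrix h) s L *ᵥ chainBeams V s L y) (r, b)) = 0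
  rw [hz, Matrix.mulVec_add]
  simp only [Matrix.mulVec_mulVec]
  rw [← Matrix.mul_assoc, ← Matrix.mul_assoc, hVW _ _ (ht _).1, hVW _ _ (ht _).2,
    Matrix.zero_mulVec, Matrix.zero_mulVec, add_zero]

/-- Filters after the chain matrix stay onto, so (L+1)d + Ld is at most the dimension (L+1)M of the
transmit side. -/
theorem CrossAligned.le_of_surjective {h : CoeffIndex M N → ℂ} (hc : CrossAligned h d)
    {s : Fin 3} {L : ℕ}
    (hT : Function.Surjective (chainMatrix (channelMatrix h) s L).mulVec) :
    (2 * L + 1) * d ≤ (L + 1) * M := by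
  obtain ⟨V, W, h1, h2, h3⟩ := hc
  have := finrank_add_finrank_le_of_comp_eq_zero (chainBeams_injective h2 s L)
    (γ := chainFilters W s L ∘ₗ (chainMatrix (channelMatrix h) s L).mulVecLin)
    ((chainFilters_surjective h3 s L).comp hT)
    (chainFilters_chainMatrix_chainBeams h1 s L)
  simp only [Module.finrank_pi_fintype, Module.finrank_self, Fintype.card_prod, Fintype.card_fin, Finset.sum_const, Finset.card_univ, smul_eq_mul,
    mul_one] at this
  linarith

/-- The chain matrix after the beams stays injective, so the same count takes place in the receive
space of dimension LN. -/
theorem CrossAligned.le_of_injective {h : CoeffIndex M N → ℂ} (hc : CrossAligned h d)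
    {s : Fin 3} {L : ℕ}
    (hT : Function.Injective (chainMatrix (channelMatrix h) s L).mulVec) :
    (2 * L + 1) * d ≤ L * N := by
  obtain ⟨V, W, h1, h2, h3⟩ := hc
  have := finrank_add_finrank_le_of_comp_eq_zero
    (α := (chainMatrix (channelMatrix h) s L).mulVecLin ∘ₗ chainBeams V s L)
    (hT.comp (chainBeams_injective h2 s L)) (chainFilters_surjective h3 s L)
    (chainFilters_chainMatrix_chainBeams h1 s L)
  simp only [Module.finrank_pi_fintype, Module.finrank_self, Fintype.card_prod, Fintype.card_fin, Finset.sum_const, Finset.card_univ, smul_eq_mul,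
    mul_one] at this
  linarith

theorem ae_not_alignmentSolvable_of_mul_lt (μ : CoeffIndex M N → Measure ℂ)
    [∀ i, IsProbabilityMeasure (μ i)] [∀ i, NullSingletonClass (μ i)] {L : ℕ} (hMN : M ≤ N)
    (hL : L * (N - M) ≤ M) (hd : (L + 1) * M < (2 * L + 1) * d) :
    ∀ᵐ h ∂Measure.pi μ, ¬ AlignmentSolvable h d := by
  filter_upwards [ae_chainMatrix_surjective μ hMN hL 0] with h hT hs
  exact hd.not_ge (hs.crossAligned.le_of_surjective hT)

theorem ae_not_alignmentSolvable_of_mul_lt' (μ : CoeffIndex M N → Measure ℂ)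
    [∀ i, IsProbabilityMeasure (μ i)] [∀ i, NullSingletonClass (μ i)] {L : ℕ} (hMN : M ≤ N)
    (hL : M ≤ L * (N - M)) (hd : L * N < (2 * L + 1) * d) :
    ∀ᵐ h ∂Measure.pi μ, ¬ AlignmentSolvable h d := by
  filter_upwards [ae_chainMatrix_injective μ hMN hL 0] with h hT hs
  exact hd.not_ge (hs.crossAligned.le_of_injective hT)

end Converse

/-! ### From beams to zero-forcing filters -/

theorem exists_linearIndependent_mem {X : Type*} [AddCommGroup X] [Module ℂ X]
    [FiniteDimensional ℂ X] {p : Submodule ℂ X} {d : ℕ} (hd : d ≤ Module.finrank ℂ p) :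
    ∃ v : Fin d → X, LinearIndependent ℂ v ∧ ∀ i, v i ∈ p :=
  let b := Module.finBasis ℂ p
  ⟨fun i => b (Fin.castLE hd i),
    (b.linearIndependent.comp _ (Fin.castLE_injective hd)).map' _ (Submodule.ker_subtype _),
    fun _ => (b _).2⟩

/-- A subspace of dimension at most `N - d` is annihilated by a filter of rank `d`. -/
theorem exists_filter_mul_eq_zero {N d : ℕ} {k : Type*} [Fintype k]
    (G : Matrix (Fin N) k ℂ) (hk : Fintype.card k + d ≤ N) :
    ∃ W : Matrix (Fin d) (Fin N) ℂ, W * G = 0 ∧ ∃ B : Matrix (Fin N) (Fin d) ℂ, W * B = 1 := by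
  have h1 := LinearMap.finrank_range_add_finrank_ker Gᵀ.mulVecLin
  have h2 := Submodule.finrank_le Gᵀ.mulVecLin.range
  rw [Module.finrank_fintype_fun_eq_card] at h1 h2
  rw [Fintype.card_fin] at h1
  have hd : d ≤ Module.finrank ℂ Gᵀ.mulVecLin.ker := by omega
  obtain ⟨v, hv, hvG⟩ := exists_linearIndependent_mem hd
  refine ⟨Matrix.of v, ?_, ?_⟩
  · ext i j
    have h := congrFun (LinearMap.mem_ker.mp (hvG i)) j
    rw [Matrix.mulVecLin_apply, Matrix.mulVec_transpose] at h
    exact h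
  · have hinj : Function.Injective (Matrix.of v)ᵀ.mulVec := Matrix.mulVec_injective_iff.mpr hv
    obtain ⟨B, hB⟩ := Matrix.exists_left_inverse_of_mulVec_injective hinj
    refine ⟨Bᵀ, ?_⟩
    rw [← Matrix.transpose_transpose (Matrix.of v), ← Matrix.transpose_mul, hB,
      Matrix.transpose_one]

/-- Reduces a design to its beams and one filter per receiver. The free index type `K` lets columns
be labelled by pairs (chain, position). -/
theorem crossAligned_of_beams {M N d : ℕ} {h : CoeffIndex M N → ℂ} {K : Type*} [Fintype K]
    [DecidableEq K] (hK : Fintype.card K = d) (V : Fin 3 → Matrix (Fin M) K ℂ)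
    (hV : ∀ i, ∃ B : Matrix K (Fin M) ℂ, B * V i = 1)
    (hW : ∀ j, ∃ W : Matrix (Fin d) (Fin N) ℂ,
      W * channelMatrix h j (j + 1) * V (j + 1) = 0 ∧
      W * channelMatrix h j (j + 2) * V (j + 2) = 0 ∧
      ∃ B : Matrix (Fin N) (Fin d) ℂ, W * B = 1) : CrossAligned h d := by
  let e := (Fintype.equivFinOfCardEq hK).symm
  choose W hW1 hW2 hW3 using hW
  refine ⟨fun i => (V i).submatrix id e, W, fun j i hij => ?_, fun i => ?_, hW3⟩
  · have hz : W j * channelMatrix h j i * V i = 0 := by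
      have : ∀ j i : Fin 3, i ≠ j → i = j + 1 ∨ i = j + 2 := by decide
      rcases this j i hij with rfl | rfl
      · exact hW1 j
      · exact hW2 j
    ext a b
    exact congrFun (congrFun hz a) (e b)
  · obtain ⟨B, hB⟩ := hV i
    refine ⟨B.submatrix e id, ?_⟩
    ext a b
    have := congrFun (congrFun hB (e a)) (e b)
    simp only [Matrix.one_apply, e.injective.eq_iff] at this ⊢
    exact this

/-! ### Square channels: invariant subspaces and cyclic alignment -/

section InvariantSubspace

/-- Triangularization over ℂ: an invariant subspace is enlarged by a lift of an eigenvector of the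
induced map on the quotient. -/
theorem exists_invariant_submodule {X : Type*} [AddCommGroup X] [Module ℂ X]
    [FiniteDimensional ℂ X] (f : Module.End ℂ X) :
    ∀ d : ℕ, d ≤ Module.finrank ℂ X →
      ∃ p : Submodule ℂ X, Module.finrank ℂ p = d ∧ p ≤ p.comap f := by
  intro d
  induction d with
  | zero => exact fun _ => ⟨⊥, finrank_bot ℂ X, bot_le⟩
  | succ d ih =>
    intro hd
    obtain ⟨p, hp, hpf⟩ := ih (by omega)
    have hq := p.finrank_quotient_add_finrank
    have : Nontrivial (X ⧸ p) := 
      Module.finrank_pos_iff.mp (by omega : 0 < Module.finrank ℂ (X ⧸ p))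
    obtain ⟨c, hc⟩ := Module.End.exists_eigenvalue (p.mapQ p f hpf)
    obtain ⟨v', hv'⟩ := hc.exists_hasEigenvector
    obtain ⟨v, rfl⟩ := p.mkQ_surjective v'
    have hv0 : v ∉ p := fun hv => hv'.2 ((Submodule.Quotient.mk_eq_zero p).mpr hv)
    have hfv : f v - c • v ∈ p := by
      have := hv'.apply_eq_smul
      rw [Submodule.mkQ_apply, Submodule.mapQ_apply, ← Submodule.Quotient.mk_smul] at this
      exact (Submodule.Quotient.eq p).mp this
    refine ⟨p ⊔ Submodule.span ℂ {v}, ?_, ?_⟩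
    · rw [Submodule.finrank_sup_span_singleton hv0, hp]
    · refine sup_le (hpf.trans (Submodule.comap_mono le_sup_left)) ?_
      rw [Submodule.span_singleton_le_iff_mem, Submodule.mem_comap]
      have : f v = (f v - c • v) + c • v := by abel
      rw [this]
      exact add_mem (Submodule.mem_sup_left hfv)
        (Submodule.mem_sup_right (Submodule.smul_mem _ _ (Submodule.mem_span_singleton_self v)))

theorem Matrix.exists_mul_eq_mul_of_le {M d : ℕ} (E : Matrix (Fin M) (Fin M) ℂ) (hd : d ≤ M) :
    ∃ (V : Matrix (Fin M) (Fin d) ℂ) (Λ : Matrix (Fin d) (Fin d) ℂ),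
      E * V = V * Λ ∧ ∃ B : Matrix (Fin d) (Fin M) ℂ, B * V = 1 := by
  obtain ⟨p, hp, hpE⟩ := exists_invariant_submodule (E.mulVecLin) d (by simpa using hd)
  obtain ⟨v, hv, hvp⟩ := exists_linearIndependent_mem hp.ge
  have hspan : Submodule.span ℂ (Set.range v) = p := by
    apply Submodule.eq_of_le_of_finrank_eq
    · rw [Submodule.span_le]
      rintro _ ⟨i, rfl⟩
      exact hvp i
    · rw [finrank_span_eq_card hv, hp, Fintype.card_fin]
  have hmem : ∀ k, ∃ c : Fin d → ℂ, ∑ i, c i • v i = E *ᵥ v k := by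
    intro k
    rw [← Submodule.mem_span_range_iff_exists_fun, hspan]
    exact hpE (hvp k)
  choose c hc using hmem
  refine ⟨(Matrix.of v)ᵀ, (Matrix.of c)ᵀ, ?_, ?_⟩
  · ext a k
    have h := congrFun (hc k) a
    rw [Finset.sum_apply] at h
    simp only [Pi.smul_apply, smul_eq_mul] at h
    calc _ = (E *ᵥ v k) a := rfl
      _ = _ := by
        rw [← h, Matrix.mul_apply]
        exact Finset.sum_congr rfl fun _ _ => mul_comm _ _
  · apply Matrix.exists_left_inverse_of_mulVec_injective
    exact Matrix.mulVec_injective_iff.mpr hv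

end InvariantSubspace

section Square

/-- Aligning at receivers 2 and 0 determines V₁ and V₂ from V₀; alignment at receiver 1 then says
that the column space of V₀ is invariant under the product of channels around the cycle.
Interference fills d dimensions everywhere, and 2d ≤ M leaves room for the filters. -/
theorem crossAligned_of_isUnit {M d : ℕ} {h : CoeffIndex M M → ℂ} (hd : 2 * d ≤ M)
    (hh : ∀ j i, (channelMatrix h j i).det ≠ 0) : CrossAligned h d := by
  set H := channelMatrix h with hH
  have inv1 : ∀ j i, (H j i)⁻¹ * H j i = 1 := fun j i => Matrix.nonsing_inv_mul _ (hh j i).isUnit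
  have inv2 : ∀ j i, H j i * (H j i)⁻¹ = 1 := fun j i => Matrix.mul_nonsing_inv _ (hh j i).isUnit
  obtain ⟨V₀, Λ, hΛ, B, hB⟩ := Matrix.exists_mul_eq_mul_of_le
    ((H 1 0)⁻¹ * (H 1 2 * ((H 0 2)⁻¹ * (H 0 1 * ((H 2 1)⁻¹ * H 2 0))))) (by omega : d ≤ M)
  obtain ⟨V₁, hV₁⟩ : ∃ V₁, V₁ = (H 2 1)⁻¹ * (H 2 0 * V₀) := ⟨_, rfl⟩
  obtain ⟨V₂, hV₂⟩ : ∃ V₂, V₂ = (H 0 2)⁻¹ * (H 0 1 * V₁) := ⟨_, rfl⟩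
  have a2 : H 2 1 * V₁ = H 2 0 * V₀ := by
    rw [hV₁, ← Matrix.mul_assoc, inv2, Matrix.one_mul]
  have a0 : H 0 2 * V₂ = H 0 1 * V₁ := by
    rw [hV₂, ← Matrix.mul_assoc, inv2, Matrix.one_mul]
  have a1 : H 1 2 * V₂ = H 1 0 * V₀ * Λ := by
    rw [Matrix.mul_assoc (H 1 0), ← hΛ, hV₂, hV₁]
    simp only [Matrix.mul_assoc]
    rw [← Matrix.mul_assoc (H 1 0) (H 1 0)⁻¹, inv2, Matrix.one_mul]
  have b1 : ∃ B : Matrix (Fin d) (Fin M) ℂ, B * V₁ = 1 := by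
    refine ⟨B * ((H 2 0)⁻¹ * H 2 1), ?_⟩
    rw [Matrix.mul_assoc, Matrix.mul_assoc, a2, ← Matrix.mul_assoc (H 2 0)⁻¹, inv1,
      Matrix.one_mul, hB]
  have b2 : ∃ B : Matrix (Fin d) (Fin M) ℂ, B * V₂ = 1 := by
    obtain ⟨B', hB'⟩ := b1
    refine ⟨B' * ((H 0 1)⁻¹ * H 0 2), ?_⟩
    rw [Matrix.mul_assoc, Matrix.mul_assoc, a0, ← Matrix.mul_assoc (H 0 1)⁻¹, inv1,
      Matrix.one_mul, hB']
  have hf : ∀ G : Matrix (Fin M) (Fin d) ℂ, ∃ W : Matrix (Fin d) (Fin M) ℂ,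
      W * G = 0 ∧ ∃ B : Matrix (Fin M) (Fin d) ℂ, W * B = 1 := fun G =>
    exists_filter_mul_eq_zero G (by rw [Fintype.card_fin]; omega)
  refine crossAligned_of_beams (Fintype.card_fin d) ![V₀, V₁, V₂] (fun i => ?_) fun j => ?_
  · fin_cases i
    · exact ⟨B, hB⟩
    · exact b1
    · exact b2
  · rw [← hH]
    fin_cases j
    · obtain ⟨W, hW, hWB⟩ := hf (H 0 1 * V₁)
      refine ⟨W, ?_, ?_, hWB⟩
      · change W * H 0 1 * V₁ = 0
        rw [Matrix.mul_assoc, hW]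
      · change W * H 0 2 * V₂ = 0
        rw [Matrix.mul_assoc, a0, hW]
    · obtain ⟨W, hW, hWB⟩ := hf (H 1 0 * V₀)
      refine ⟨W, ?_, ?_, hWB⟩
      · change W * H 1 2 * V₂ = 0
        rw [Matrix.mul_assoc, a1, ← Matrix.mul_assoc, hW, Matrix.zero_mul]
      · change W * H 1 0 * V₀ = 0
        rw [Matrix.mul_assoc, hW]
    · obtain ⟨W, hW, hWB⟩ := hf (H 2 0 * V₀)
      refine ⟨W, ?_, ?_, hWB⟩
      · change W * H 2 0 * V₀ = 0
        rw [Matrix.mul_assoc, hW]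
      · change W * H 2 1 * V₁ = 0
        rw [Matrix.mul_assoc, a2, hW]

theorem ae_alignmentSolvable_square {M d : ℕ} (μ : CoeffIndex M M → Measure ℂ)
    [∀ i, IsProbabilityMeasure (μ i)] [∀ i, NullSingletonClass (μ i)] (hd : 2 * d ≤ M) :
    ∀ᵐ h ∂Measure.pi μ, AlignmentSolvable h d := by
  apply ae_alignmentSolvable_of_ae_crossAligned μ
  have : ∀ᵐ h ∂Measure.pi μ, ∀ j i, (channelMatrix h j i).det ≠ 0 := by
    rw [ae_all_iff]
    intro j
    rw [ae_all_iff]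
    intro i
    simp only [← genericChannel_map_eval]
    apply ae_det_map_eval_ne_zero μ _ (h₀ := fun e => if e.2.2.1 = e.2.2.2 then 1 else 0)
    rw [genericChannel_map_eval]
    change (Matrix.of fun b a : Fin M => if b = a then (1 : ℂ) else 0).det ≠ 0
    have : (Matrix.of fun b a : Fin M => if b = a then (1 : ℂ) else 0) = 1 := by
      ext b a
      simp [Matrix.one_apply]
    rw [this, Matrix.det_one]
    exact one_ne_zero
  filter_upwards [this] with h hh
  exact crossAligned_of_isUnit hd hh

end Square

/-! ### Achievability for M < N: families of chains -/

/-- A kernel vector of a surjective specialization of a polynomial matrix extends to a polynomial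
family of kernel vectors. -/
theorem exists_polynomial_kernel {ι m n : Type*} [Fintype m] [Fintype n] [DecidableEq m]
    (T : Matrix m n (MvPolynomial ι ℂ)) {h₀ : ι → ℂ}
    (hT : Function.Surjective (T.map (MvPolynomial.eval h₀)).mulVec) {w : n → ℂ}
    (hw : T.map (MvPolynomial.eval h₀) *ᵥ w = 0) :
    ∃ z : n → MvPolynomial ι ℂ, T *ᵥ z = 0 ∧ ∀ k, MvPolynomial.eval h₀ (z k) = w k := by
  obtain ⟨B, hB⟩ := Matrix.mulVec_surjective_iff_exists_right_inverse.mp hT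
  let B' : Matrix n m (MvPolynomial ι ℂ) := B.map MvPolynomial.C
  let w' : n → MvPolynomial ι ℂ := fun k => MvPolynomial.C (w k)
  let D := T * B'
  -- Cramer's rule without denominators: the constant vector `w'` is corrected by a multiple of its
  -- defect `T *ᵥ w'`. At `h₀` the defect vanishes and `D` is the identity.
  refine ⟨D.det • w' - B' *ᵥ (D.adjugate *ᵥ (T *ᵥ w')), ?_, fun k => ?_⟩
  · rw [Matrix.mulVec_sub, Matrix.mulVec_smul, Matrix.mulVec_mulVec, Matrix.mulVec_mulVec,
      show T * B' * D.adjugate = D.det • 1 from Matrix.mul_adjugate D, Matrix.smul_mulVec, Matrix.one_mulVec, sub_self]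
  · have hD : MvPolynomial.eval h₀ D.det = 1 := by
      rw [RingHom.map_det, RingHom.mapMatrix_apply, Matrix.map_mul, map_eval_map_C, hB,
        Matrix.det_one]
    have hw' : MvPolynomial.eval h₀ ∘ w' = w := by
      funext k
      simp [w']
    have hTw : MvPolynomial.eval h₀ ∘ (T *ᵥ w') = 0 := by
      funext i
      rw [Function.comp_apply, RingHom.map_mulVec, hw', hw]
    have hadj : MvPolynomial.eval h₀ ∘ (D.adjugate *ᵥ (T *ᵥ w')) = 0 := by
      funext i
      rw [Function.comp_apply, RingHom.map_mulVec, hTw, Matrix.mulVec_zero]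
    rw [Pi.sub_apply, map_sub, RingHom.map_mulVec, hadj, Matrix.mulVec_zero, Pi.smul_apply,
      smul_eq_mul, map_mul, hD]
    simp [w']

/-- The starting transmitter of the alignment chain whose `r`-th beam is sent by `t`. -/
def chainStart (t : Fin 3) (r : ℕ) : Fin 3 := t - r • (1 : Fin 3)

theorem chainTx_chainStart (t : Fin 3) (r : ℕ) : chainTx (chainStart t r) r = t := by
  rw [chainTx, chainStart, sub_add_cancel]

theorem chainStart_succ (t : Fin 3) (r : ℕ) : chainStart (t + 1) (r + 1) = chainStart t r := by
  rw [chainStart, chainStart, succ_nsmul]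
  abel

/-- The chain of coordinate vectors with indices `e + L δ, …, e + δ, e`, where `δ = N - M`. -/
def shiftChain (M N L e : ℕ) : Fin (L + 1) × Fin M → ℂ :=
  fun p => if (p.2 : ℕ) = (L - p.1) * (N - M) + e then 1 else 0

theorem chainMatrix_mulVec_shiftChain {M N L e : ℕ} (hMN : M ≤ N)
    (he : L ≠ 0 → L * (N - M) + e < M) (s : Fin 3) :
    chainMatrix (channelMatrix (shiftCoeff M N)) s L *ᵥ shiftChain M N L e = 0 := by
  funext p
  obtain ⟨r, b⟩ := p
  rw [chainMatrix_mulVec, channelMatrix_shiftCoeff_mulVec_left,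
    channelMatrix_shiftCoeff_mulVec_right hMN, Pi.zero_apply, add_neg_eq_zero]
  -- The existence of a link `r` forces `L ≠ 0`.
  have hL : L * (N - M) + e < M := he (by have := r.2; omega)
  have hsub : L - (r : ℕ) = (L - (r + 1 : ℕ)) + 1 := by have := r.2; omega
  have hmul : (L - (r : ℕ)) * (N - M) = (L - (r + 1 : ℕ)) * (N - M) + (N - M) := by
    rw [hsub, add_mul, one_mul]
  have hle : (L - (r : ℕ)) * (N - M) ≤ L * (N - M) := Nat.mul_le_mul_right _ (Nat.sub_le _ _)
  simp only [shiftChain, Fin.val_castSucc, Fin.val_succ]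
  split_ifs <;> first | rfl | omega

section Achievability

variable {M N d c : ℕ} {n : Fin c → ℕ}

/-- Index of the unit vector used at the shift realization by the `i`-th beam of chain `e`. -/
def shiftPosition (hn : ∀ e, 0 < n e → (n e - 1) * (N - M) + e < M) (k : Σ e, Fin (n e)) :
    Fin M :=
  ⟨(n k.1 - 1 - k.2) * (N - M) + k.1, by
    have h1 := hn k.1 (by have := k.2.2; omega)
    have h2 : (n k.1 - 1 - k.2) * (N - M) ≤ (n k.1 - 1) * (N - M) :=
      Nat.mul_le_mul_right _ (Nat.sub_le _ _)
    omega⟩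

/-- The remainder modulo N - M recovers `e`, because e < c ≤ N - M; the quotient recovers the
position. -/
theorem shiftPosition_injective (hc : c ≤ N - M)
    (hn : ∀ e, 0 < n e → (n e - 1) * (N - M) + e < M) :
    Function.Injective (shiftPosition hn) := by
  rintro ⟨e, i⟩ ⟨e', i'⟩ h
  have h := congrArg Fin.val h
  simp only [shiftPosition] at h
  have he := e.2
  have he' := e'.2
  have hee : e = e' := by
    have := congrArg (· % (N - M)) h
    simp only [Nat.mul_add_mod_self_right] at this
    rw [Nat.mod_eq_of_lt (by omega), Nat.mod_eq_of_lt (by omega)] at this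
    exact Fin.ext this
  subst hee
  have h2 := Nat.eq_of_mul_eq_mul_right (by omega : 0 < N - M) (Nat.add_right_cancel h)
  have hi := i.2
  have hi' := i'.2
  have : i = i' := Fin.ext (by omega)
  rw [this]

/-- At receiver `j` every non-initial beam of transmitter `j + 2` is the negative of its predecessor
from `j + 1`. Interference thus spans at most d + c dimensions, and c + 2d ≤ N leaves room for the
filter. The beams of one transmitter are distinct unit vectors at the shift realization, hence
generically independent. -/
theorem ae_crossAligned_of_chains (μ : CoeffIndex M N → Measure ℂ)
    [∀ i, IsProbabilityMeasure (μ i)] [∀ i, NullSingletonClass (μ i)] (hMN : M ≤ N)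
    (hc : c ≤ N - M) (hn : ∀ e, 0 < n e → (n e - 1) * (N - M) + e < M) (hsum : ∑ e, n e = d)
    (hcd : c + 2 * d ≤ N) :
    ∀ᵐ h ∂Measure.pi μ, CrossAligned h d := by
  have hle : ∀ e, (n e - 1) * (N - M) ≤ M := by
    intro e
    rcases Nat.eq_zero_or_pos (n e) with h0 | hpos
    · simp [h0]
    · have := hn e hpos
      omega
  have hex : ∀ (s : Fin 3) (e : Fin c), ∃ z : Fin (n e - 1 + 1) × Fin M →
      MvPolynomial (CoeffIndex M N) ℂ, chainMatrix (genericChannel M N) s (n e - 1) *ᵥ z = 0 ∧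
      ∀ k, MvPolynomial.eval (shiftCoeff M N) (z k) = shiftChain M N (n e - 1) e k := by
    intro s e
    apply exists_polynomial_kernel
    · rw [chainMatrix_genericChannel_map_eval]
      exact chainMatrix_shiftCoeff_surjective hMN (hle e) s
    · rw [chainMatrix_genericChannel_map_eval]
      exact chainMatrix_mulVec_shiftChain hMN (fun h => hn e (by omega)) s
  choose z hz0 hz using hex
  let P : Fin 3 → Matrix (Fin M) (Σ e, Fin (n e)) (MvPolynomial (CoeffIndex M N) ℂ) := fun t =>
    -- Chains start at all three transmitters; the `r`-th beam at `t` comes from the chain begun `r`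
    -- users earlier.
    Matrix.of fun a k => z (chainStart t k.2) k.1 (⟨k.2, by have := k.2.2; omega⟩, a)
  have hP : ∀ t, ((P t).map (MvPolynomial.eval (shiftCoeff M N))) =
      (1 : Matrix (Fin M) (Fin M) ℂ).submatrix id (shiftPosition hn) := by
    intro t
    ext a k
    simp only [P, Matrix.map_apply, Matrix.of_apply, hz, shiftChain, Matrix.submatrix_apply,
      Matrix.one_apply, id, shiftPosition, Fin.ext_iff]
  have hPinv : ∀ t, (1 : Matrix (Fin M) (Fin M) ℂ).submatrix (shiftPosition hn) id *
      ((P t).map (MvPolynomial.eval (shiftCoeff M N))) = 1 := by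
    intro t
    rw [hP, ← Matrix.submatrix_mul _ _ _ _ _ Function.bijective_id, Matrix.one_mul,
      Matrix.submatrix_one _ (shiftPosition_injective hc hn)]
  have hgen : ∀ᵐ h ∂Measure.pi μ, ∀ t, ∃ B : Matrix (Σ e, Fin (n e)) (Fin M) ℂ,
      B * (P t).map (MvPolynomial.eval h) = 1 :=
    ae_all_iff.mpr fun t => ae_exists_left_inverse μ (P t) (hPinv t)
  filter_upwards [hgen] with h hh
  have hcol : ∀ (t : Fin 3) (e : Fin c) (r : ℕ) (hr : r + 1 < n e),
      channelMatrix h (t + 2) t *ᵥ (fun a => (P t).map (MvPolynomial.eval h) a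
        ⟨e, ⟨r, by omega⟩⟩) + channelMatrix h (t + 2) (t + 1) *ᵥ (fun a =>
        (P (t + 1)).map (MvPolynomial.eval h) a ⟨e, ⟨r + 1, hr⟩⟩) = 0 := by
    intro t e r hr
    funext b
    have h0 := congrFun (hz0 (chainStart t r) e) (⟨r, by omega⟩, b)
    have h1 := congrArg (MvPolynomial.eval h) h0
    rw [RingHom.map_mulVec, chainMatrix_genericChannel_map_eval, chainMatrix_mulVec,
      Pi.zero_apply, map_zero] at h1
    simp only [chainTx_chainStart] at h1
    simp only [Matrix.map_apply, P, Matrix.of_apply, chainStart_succ, Pi.add_apply]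
    exact h1
  -- The chain heads, which have no predecessor to align with. An empty chain (`n e = 0`) adds a
  -- spurious but harmless column.
  let Q : Fin 3 → Matrix (Fin M) (Fin c) ℂ := fun t =>
    Matrix.of fun a e => MvPolynomial.eval h (z t e (0, a))
  have hcard : Fintype.card (Σ e, Fin (n e)) = d := by simp [hsum]
  refine crossAligned_of_beams hcard (fun t => (P t).map (MvPolynomial.eval h)) hh fun j => ?_
  obtain ⟨W, hW, hWB⟩ := exists_filter_mul_eq_zero (d := d)
    (Matrix.fromCols (channelMatrix h j (j + 1) * (P (j + 1)).map (MvPolynomial.eval h))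
      (channelMatrix h j (j + 2) * Q (j + 2)))
    (by rw [Fintype.card_sum, hcard, Fintype.card_fin]; omega)
  rw [Matrix.mul_fromCols, ← Matrix.fromCols_zero, Matrix.fromCols_inj.eq_iff] at hW
  obtain ⟨hW1, hW2⟩ := hW
  refine ⟨W, by rw [Matrix.mul_assoc, hW1], ?_, hWB⟩
  rw [Matrix.mul_assoc]
  ext a ⟨e, ⟨r, hr⟩⟩
  rcases r with _ | r
  · have hstart : chainStart (j + 2) 0 = j + 2 := by rw [chainStart, zero_nsmul, sub_zero]
    have h0 := congrFun (congrFun hW2 a) e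
    refine Eq.trans ?_ h0
    change (W *ᵥ (channelMatrix h j (j + 2) *ᵥ fun a' =>
      MvPolynomial.eval h (z (chainStart (j + 2) 0) e (0, a')))) a = _
    rw [hstart]
    rfl
  · have hj : j + 1 + 2 = j ∧ j + 1 + 1 = j + 2 :=
      (by decide : ∀ j : Fin 3, j + 1 + 2 = j ∧ j + 1 + 1 = j + 2) j
    have h0 := hcol (j + 1) e r hr
    rw [hj.1, hj.2, add_comm, add_eq_zero_iff_eq_neg] at h0
    have h1 := congrFun (congrFun hW1 a) ⟨e, ⟨r, by omega⟩⟩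
    change (W *ᵥ (channelMatrix h j (j + 1) *ᵥ fun a' =>
      (P (j + 1)).map (MvPolynomial.eval h) a' ⟨e, ⟨r, by omega⟩⟩)) a = 0 at h1
    change (W *ᵥ (channelMatrix h j (j + 2) *ᵥ fun a' =>
      (P (j + 2)).map (MvPolynomial.eval h) a' ⟨e, ⟨r + 1, hr⟩⟩)) a = 0
    rw [h0, Matrix.mulVec_neg, Pi.neg_apply, h1, neg_zero]

end Achievability

/-! ### Choice of the chain lengths -/

theorem exists_le_sum_eq {c : ℕ} (f : Fin c → ℕ) :
    ∀ d : ℕ, d ≤ ∑ e, f e → ∃ n : Fin c → ℕ, (∀ e, n e ≤ f e) ∧ ∑ e, n e = d := by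
  intro d
  induction d with
  | zero => exact fun _ => ⟨0, fun _ => Nat.zero_le _, by simp⟩
  | succ d ih =>
    intro hd
    obtain ⟨n, hn, hs⟩ := ih (by omega)
    obtain ⟨e, -, he⟩ := Finset.exists_lt_of_sum_lt (by omega : ∑ e, n e < ∑ e, f e)
    refine ⟨n + Pi.single e 1, fun e' => ?_, ?_⟩
    · rw [Pi.add_apply]
      rcases eq_or_ne e' e with rfl | hne
      · rw [Pi.single_eq_same]
        omega
      · rw [Pi.single_eq_of_ne hne]
        exact hn e'
    · simp only [Pi.add_apply, Finset.sum_add_distrib, hs]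
      rw [Finset.sum_pi_single']
      simp

theorem sum_add_ite_lt (L ρ c : ℕ) :
    ∑ e : Fin c, (L + if (e : ℕ) < ρ then 1 else 0) = c * L + min c ρ := by
  rw [Fin.sum_univ_eq_sum_range (fun e => L + if e < ρ then 1 else 0), Finset.sum_add_distrib,
    Finset.sum_const, Finset.card_range, smul_eq_mul, Finset.sum_boole]
  have : Finset.filter (· < ρ) (Finset.range c) = Finset.range (min c ρ) := by
    ext x
    simp
  rw [this, Finset.card_range, Nat.cast_id]

theorem ae_alignmentSolvable_of_mul_le {M N L d : ℕ} (μ : CoeffIndex M N → Measure ℂ)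
    [∀ i, IsProbabilityMeasure (μ i)] [∀ i, NullSingletonClass (μ i)] (hMN : M < N)
    (hL : L * (N - M) < M) (hL' : M ≤ (L + 1) * (N - M)) (h1 : (2 * L + 1) * d ≤ (L + 1) * M)
    (h2 : (2 * L + 3) * d ≤ (L + 1) * N) :
    ∀ᵐ h ∂Measure.pi μ, AlignmentSolvable h d := by
  apply ae_alignmentSolvable_of_ae_crossAligned μ
  have h2d : 2 * d ≤ N := by
    by_contra! h
    nlinarith
  have hdM : d ≤ M := by
    by_contra! h
    nlinarith
  obtain ⟨δ, hδ⟩ : ∃ δ, δ = N - M := ⟨_, rfl⟩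
  have hN : N = M + δ := by omega
  rw [← hδ] at hL hL'
  -- Here 0 < ρ ≤ δ. Chain `e` has room for L + 1 beams if e < ρ and for L beams otherwise.
  obtain ⟨ρ, hρ⟩ : ∃ ρ, M = L * δ + ρ := ⟨M - L * δ, by omega⟩
  obtain ⟨c, hc⟩ : ∃ c, c = min (N - 2 * d) δ := ⟨_, rfl⟩
  -- The capacity cL + min(c, ρ) is M when c = δ. When c = N - 2d, it is at least d by `h2` if c ≤ ρ
  -- and by `h1` if c ≥ ρ.
  obtain ⟨n, hn, hsum⟩ := exists_le_sum_eq
    (fun e : Fin c => L + if (e : ℕ) < ρ then 1 else 0) d (by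
      rw [sum_add_ite_lt]
      rcases le_total δ (N - 2 * d) with h | h
      · rw [min_eq_right h] at hc
        rw [add_mul, one_mul, hρ] at hL'
        rw [hc, min_eq_right (by omega), mul_comm, ← hρ]
        exact hdM
      · rw [min_eq_left h] at hc
        have h3 : c + 2 * d = N := by omega
        rcases le_total c ρ with h' | h'
        · rw [min_eq_left h']
          nlinarith
        · rw [min_eq_right h']
          nlinarith)
  apply ae_crossAligned_of_chains μ hMN.le (c := c) (n := n) (by omega) _ hsum (by omega)
  intro e he
  rw [← hδ]
  have hne := hn e
  have hec : (e : ℕ) < δ := by have := e.2; omega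
  split_ifs at hne with hlt
  · have : (n e - 1) * δ ≤ L * δ := Nat.mul_le_mul_right _ (by omega)
    omega
  · have : (n e - 1 + 1) * δ ≤ L * δ := Nat.mul_le_mul_right _ (by omega)
    rw [add_mul, one_mul] at this
    omega

/-! ### Integer form of the DoF⋆ bound, and feasibility -/

theorem dofStar_comm (MT MR : ℕ) : dofStar MR MT = dofStar MT MR := by
  unfold dofStar chainLength
  rw [min_comm MR MT, max_comm MR MT]
  split_ifs with h1 h2 h2
  · rw [h1]
  · exact absurd h1.symm h2
  · exact absurd h2.symm h1
  · rfl

theorem natCast_le_dofStar_self_iff (M d : ℕ) : (d : ℚ) ≤ dofStar M M ↔ 2 * d ≤ M := by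
  rw [dofStar, if_pos rfl, le_div_iff₀ two_pos, mul_comm]
  exact_mod_cast Iff.rfl

theorem natCast_le_dofStar_iff {M N : ℕ} (hM : 0 < M) (hMN : M < N) :
    ∃ L : ℕ, L * (N - M) < M ∧ M ≤ (L + 1) * (N - M) ∧ ∀ d : ℕ, (d : ℚ) ≤ dofStar M N ↔
      (2 * L + 1) * d ≤ (L + 1) * M ∧ (2 * L + 3) * d ≤ (L + 1) * N := by
  have hδ : (0 : ℚ) < (N : ℚ) - M := by
    have : (M : ℚ) < N := by exact_mod_cast hMN
    linarith
  have hM' : (0 : ℚ) < M := by exact_mod_cast hM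
  have hchain : chainLength M N = ⌈(M : ℚ) / ((N : ℚ) - M)⌉₊ := by
    rw [chainLength, min_eq_left hMN.le, max_eq_right hMN.le]
  -- L = κ - 1, the number of links in a chain of κ beams.
  obtain ⟨L, hL⟩ : ∃ L, chainLength M N = L + 1 := by
    apply Nat.exists_eq_add_one.mpr
    rw [hchain, Nat.ceil_pos]
    positivity
  have hlt : (L : ℚ) < (M : ℚ) / ((N : ℚ) - M) := Nat.lt_ceil.mp (by omega)
  have hle : (M : ℚ) / ((N : ℚ) - M) ≤ (L + 1 : ℕ) := Nat.ceil_le.mp (by omega)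
  rw [lt_div_iff₀ hδ] at hlt
  rw [div_le_iff₀ hδ] at hle
  refine ⟨L, ?_, ?_, fun d => ?_⟩
  · have : ((L * (N - M) : ℕ) : ℚ) < M := by
      rw [Nat.cast_mul, Nat.cast_sub hMN.le]
      exact hlt
    exact_mod_cast this
  · have : (M : ℚ) ≤ ((L + 1) * (N - M) : ℕ) := by
      rw [Nat.cast_mul, Nat.cast_sub hMN.le]
      exact hle
    exact_mod_cast this
  · rw [dofStar, if_neg hMN.ne, min_eq_left hMN.le, max_eq_right hMN.le, hL, le_min_iff]
    have hL0 : (0 : ℚ) < (L + 1 : ℕ) := by positivity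
    have e1 : (M : ℚ) / (2 - 1 / (L + 1 : ℕ)) = ((L + 1) * M : ℕ) / (2 * L + 1 : ℕ) := by
      have : (2 : ℚ) - 1 / (L + 1 : ℕ) = (2 * L + 1 : ℕ) / (L + 1 : ℕ) := by
        field_simp
        push_cast
        ring
      rw [this]
      push_cast
      field_simp
    have e2 : (N : ℚ) / (2 + 1 / (L + 1 : ℕ)) = ((L + 1) * N : ℕ) / (2 * L + 3 : ℕ) := by
      have : (2 : ℚ) + 1 / (L + 1 : ℕ) = (2 * L + 3 : ℕ) / (L + 1 : ℕ) := by
        field_simp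
        push_cast
        ring
      rw [this]
      push_cast
      field_simp
    rw [e1, e2, le_div_iff₀ (by positivity), le_div_iff₀ (by positivity)]
    rw [mul_comm (d : ℚ), mul_comm (d : ℚ)]
    exact_mod_cast Iff.rfl

theorem IsContinuousLaw.isProbabilityMeasure {MT MR : ℕ} {μ : CoeffIndex MT MR → Measure ℂ}
    (hμ : IsContinuousLaw μ) (e : CoeffIndex MT MR) : IsProbabilityMeasure (μ e) := (hμ e).1

theorem IsContinuousLaw.nullSingletonClass {MT MR : ℕ} {μ : CoeffIndex MT MR → Measure ℂ}
    (hμ : IsContinuousLaw μ) (e : CoeffIndex MT MR) : NullSingletonClass (μ e) := ⟨(hμ e).2⟩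

theorem feasible_of_le_dofStar_of_le {M N d : ℕ} (hM : 0 < M) (hMN : M ≤ N)
    {μ : CoeffIndex M N → Measure ℂ} (hμ : IsContinuousLaw μ) (hd : (d : ℚ) ≤ dofStar M N) :
    Feasible μ d := by
  have := hμ.isProbabilityMeasure
  have := hμ.nullSingletonClass
  rcases hMN.eq_or_lt with rfl | hlt
  · exact ae_alignmentSolvable_square μ ((natCast_le_dofStar_self_iff M d).mp hd)
  · obtain ⟨L, hL, hL', hiff⟩ := natCast_le_dofStar_iff hM hlt
    obtain ⟨h1, h2⟩ := (hiff d).mp hd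
    exact ae_alignmentSolvable_of_mul_le μ hlt hL hL' h1 h2

theorem infeasible_of_dofStar_lt_of_le {M N d : ℕ} (hM : 0 < M) (hMN : M ≤ N)
    {μ : CoeffIndex M N → Measure ℂ} (hμ : IsContinuousLaw μ) (hd : dofStar M N < (d : ℚ)) :
    Infeasible μ d := by
  have := hμ.isProbabilityMeasure
  have := hμ.nullSingletonClass
  rcases hMN.eq_or_lt with rfl | hlt
  · have h2 : M < 2 * d := by
      by_contra! h
      exact hd.not_ge ((natCast_le_dofStar_self_iff M d).mpr h)
    -- With δ = 0 every L is allowed. For M ≤ 2d - 1, L = d is long enough: (d+1)(2d-1) = (2d+1)d -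
    -- 1.
    exact ae_not_alignmentSolvable_of_mul_lt μ (L := d) le_rfl (by simp) (by nlinarith)
  · obtain ⟨L, hL, hL', hiff⟩ := natCast_le_dofStar_iff hM hlt
    have h := mt (hiff d).mpr hd.not_ge
    rw [not_and_or, not_le, not_le] at h
    -- The first bound fails along L = κ - 1 links, the second along L + 1 = κ.
    rcases h with h | h
    · exact ae_not_alignmentSolvable_of_mul_lt μ hMN hL.le h
    · exact ae_not_alignmentSolvable_of_mul_lt' μ hMN hL' (by linarith)

theorem IsContinuousLaw.swap {MT MR : ℕ} {μ : CoeffIndex MT MR → Measure ℂ}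
    (hμ : IsContinuousLaw μ) : IsContinuousLaw (fun e => μ (swapIndex MT MR e)) :=
  fun e => hμ (swapIndex MT MR e)

section Feasibility

variable {MT MR d : ℕ} {μ : CoeffIndex MT MR → Measure ℂ}

theorem feasible_of_le_dofStar (hMT : 0 < MT) (hMR : 0 < MR) (hμ : IsContinuousLaw μ)
    (hd : (d : ℚ) ≤ dofStar MT MR) : Feasible μ d := by
  rcases le_total MT MR with h | h
  · exact feasible_of_le_dofStar_of_le hMT h hμ hd
  · have := hμ.isProbabilityMeasure
    rw [← dofStar_comm] at hd
    exact (feasible_swap_iff μ).mp (feasible_of_le_dofStar_of_le hMR h hμ.swap hd)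

theorem infeasible_of_dofStar_lt (hMT : 0 < MT) (hMR : 0 < MR) (hμ : IsContinuousLaw μ)
    (hd : dofStar MT MR < (d : ℚ)) : Infeasible μ d := by
  rcases le_total MT MR with h | h
  · exact infeasible_of_dofStar_lt_of_le hMT h hμ hd
  · have := hμ.isProbabilityMeasure
    rw [← dofStar_comm] at hd
    exact (infeasible_swap_iff μ).mp (infeasible_of_dofStar_lt_of_le hMR h hμ.swap hd)

theorem not_feasible_of_infeasible (hμ : IsContinuousLaw μ) (hi : Infeasible μ d) :
    ¬ Feasible μ d := by
  have := hμ.isProbabilityMeasure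
  intro hf
  obtain ⟨h, h1, h2⟩ := (Filter.Eventually.and hf hi).exists
  exact h2 h1

theorem feasible_iff_le_dofStar (hMT : 0 < MT) (hMR : 0 < MR) (hμ : IsContinuousLaw μ) :
    Feasible μ d ↔ (d : ℚ) ≤ dofStar MT MR := by
  refine ⟨fun hf => ?_, feasible_of_le_dofStar hMT hMR hμ⟩
  by_contra! hd
  exact not_feasible_of_infeasible hμ (infeasible_of_dofStar_lt hMT hMR hμ hd) hf

theorem infeasible_iff_dofStar_lt (hMT : 0 < MT) (hMR : 0 < MR) (hμ : IsContinuousLaw μ) :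
    Infeasible μ d ↔ dofStar MT MR < (d : ℚ) := by
  refine ⟨fun hi => ?_, infeasible_of_dofStar_lt hMT hMR hμ⟩
  by_contra! hd
  exact not_feasible_of_infeasible hμ hi (feasible_of_le_dofStar hMT hMR hμ hd)

end Feasibility

/-! ### Proper systems and the set B -/

section Proper

theorem antennaRatio_comm (MT MR : ℕ) : antennaRatio MR MT = antennaRatio MT MR := by
  rw [antennaRatio, antennaRatio, min_comm, max_comm]

theorem IsProper.symm {MT MR d : ℕ} (h : IsProper MT MR d) : IsProper MR MT d := by
  rwa [IsProper, add_comm]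

theorem dofStar_lt_of_ratio_not_mem {p q : ℕ} (hp : 0 < p) (hpq : p < q)
    (hB : (p : ℚ) / q ∉ ratioSetB) : dofStar (4 * p) (4 * q) < ((p + q : ℕ) : ℚ) := by
  obtain ⟨L, -, -, hiff⟩ := natCast_le_dofStar_iff (by omega : 0 < 4 * p)
    (by omega : 4 * p < 4 * q)
  by_contra! hle
  obtain ⟨h1, h2⟩ := (hiff _).mp hle
  apply hB
  refine ⟨L + 1, by omega, ?_⟩
  -- With M = 4p, N = 4q and d = p + q, the two bounds are the two opposite inequalities between
  -- these sides.
  have heq : (2 * L + 1) * q = (2 * L + 3) * p := by nlinarith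
  have heq' : (2 * (L : ℚ) + 1) * q = (2 * L + 3) * p := by exact_mod_cast heq
  have hq : (0 : ℚ) < q := by exact_mod_cast (by omega : 0 < q)
  rw [div_eq_div_iff hq.ne' (by positivity)]
  push_cast
  linarith

theorem le_dofStar_of_isProper_of_le {M N d : ℕ} (hM : 0 < M) (hMN : M ≤ N)
    (hr : antennaRatio M N ∈ ratioSetB ∨ antennaRatio M N = 1) (hd : IsProper M N d) :
    (d : ℚ) ≤ dofStar M N := by
  have hN : (0 : ℚ) < N := by exact_mod_cast (by omega : 0 < N)
  rw [IsProper, le_div_iff₀ (by norm_num)] at hd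
  have hd' : d * 4 ≤ M + N := by exact_mod_cast hd
  rw [antennaRatio, min_eq_left hMN, max_eq_right hMN] at hr
  rcases hMN.eq_or_lt with rfl | hlt
  · rw [natCast_le_dofStar_self_iff]
    omega
  · rcases hr with ⟨p, hp, hr⟩ | hr
    · obtain ⟨r, rfl⟩ : ∃ r, p = r + 1 := Nat.exists_eq_add_one.mpr hp
      rw [div_eq_div_iff hN.ne' (by positivity)] at hr
      push_cast at hr
      have heq : (2 * r + 3) * M = (2 * r + 1) * N := by
        have : ((2 * r + 3) * M : ℚ) = (2 * r + 1) * N := by linarith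
        exact_mod_cast this
      obtain ⟨L, hL1, hL2, hiff⟩ := natCast_le_dofStar_iff hM hlt
      obtain ⟨δ, rfl⟩ : ∃ δ, N = M + δ := ⟨N - M, by omega⟩
      rw [Nat.add_sub_cancel_left] at hL1 hL2
      have h2M : 2 * M = (2 * r + 1) * δ := by linarith
      -- M = (r + 1/2)δ lies strictly between rδ and (r+1)δ, so κ = r + 1.
      have hLr : L = r := by
        apply le_antisymm
        · by_contra! h
          nlinarith
        · by_contra! h
          nlinarith
      subst hLr
      rw [hiff]
      constructor <;> nlinarith
    · rw [div_eq_one_iff_eq hN.ne'] at hr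
      have : M = N := by exact_mod_cast hr
      omega

theorem le_dofStar_of_isProper {MT MR d : ℕ} (hMT : 0 < MT) (hMR : 0 < MR)
    (hr : antennaRatio MT MR ∈ ratioSetB ∨ antennaRatio MT MR = 1) (hd : IsProper MT MR d) :
    (d : ℚ) ≤ dofStar MT MR := by
  rcases le_total MT MR with h | h
  · exact le_dofStar_of_isProper_of_le hMT h hr hd
  · rw [← antennaRatio_comm] at hr
    rw [← dofStar_comm]
    exact le_dofStar_of_isProper_of_le hMR h hr hd.symm

end Proper

theorem theorem2 :
    (∀ MT MR d : ℕ, 0 < MT → 0 < MR →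
      ∀ μ : CoeffIndex MT MR → Measure ℂ, IsContinuousLaw μ →
        (Feasible μ d ↔ (d : ℚ) ≤ dofStar MT MR) ∧
        (Feasible μ d ↔ (d : ℤ) ≤ ⌊dofStar MT MR⌋) ∧
        (Infeasible μ d ↔ dofStar MT MR < (d : ℚ))) ∧
    (∀ γ : ℚ, 0 < γ → γ < 1 → γ ∉ ratioSetB →
      ∃ MT MR d : ℕ, 0 < MT ∧ 0 < MR ∧ antennaRatio MT MR = γ ∧ IsProper MT MR d ∧
        ∀ μ : CoeffIndex MT MR → Measure ℂ, IsContinuousLaw μ → Infeasible μ d) ∧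
    (∀ MT MR d : ℕ, 0 < MT → 0 < MR →
      (antennaRatio MT MR ∈ ratioSetB ∨ antennaRatio MT MR = 1) → IsProper MT MR d →
        ∀ μ : CoeffIndex MT MR → Measure ℂ, IsContinuousLaw μ → Feasible μ d) := by
  refine ⟨fun MT MR d hMT hMR μ hμ => ⟨feasible_iff_le_dofStar hMT hMR hμ, ?_,
    infeasible_iff_dofStar_lt hMT hMR hμ⟩, fun γ h0 h1 hγ => ?_,
    fun MT MR d hMT hMR hr hd μ hμ =>
      feasible_of_le_dofStar hMT hMR hμ (le_dofStar_of_isProper hMT hMR hr hd)⟩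
  · rw [feasible_iff_le_dofStar hMT hMR hμ, Int.le_floor, Int.cast_natCast]
  · obtain ⟨p, hp⟩ : ∃ p : ℕ, (p : ℤ) = γ.num :=
      ⟨γ.num.toNat, Int.toNat_of_nonneg (Rat.num_pos.mpr h0).le⟩
    have hq : 0 < γ.den := γ.den_pos
    have hq' : (0 : ℚ) < γ.den := by exact_mod_cast hq
    have hpγ : (p : ℚ) / γ.den = γ := by
      rw [← Int.cast_natCast, hp, Rat.num_div_den]
    have hp0 : 0 < p := by
      have := Rat.num_pos.mpr h0
      omega
    have hpq : p < γ.den := by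
      have : (p : ℚ) / γ.den < 1 := by rwa [hpγ]
      rw [div_lt_one hq'] at this
      exact_mod_cast this
    -- The factor 4 makes (M+N)/4 an integer, so the demand meets the proper bound with equality.
    refine ⟨4 * p, 4 * γ.den, p + γ.den, by omega, by omega, ?_, ?_, fun μ hμ => ?_⟩
    · rw [antennaRatio, min_eq_left (by omega), max_eq_right (by omega), ← hpγ, hpγ]
      push_cast
      rw [mul_div_mul_left _ _ (by norm_num), hpγ]
    · rw [IsProper]
      push_cast
      linarith
    · exact infeasible_of_dofStar_lt (by omega) (by omega) hμ
        (dofStar_lt_of_ratio_not_mem hp0 hpq (hpγ.symm ▸ hγ))
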